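/- Let $s \ge 2$ be an integer. For a prime $p$ put $A = (\mathbb{Z}/p)[x_1,\dots,x_s]$ and $h = \sum_{i=1}^s x_i^2 \in A$. For $n \ge 0$ let $q = p^n$ and let $e_n = e_n(h)$ be the colength (the length of the quotient $A$-module $A/I$) of the ideal $I = (h, x_1^q, \dots, x_s^q)$ of $A$. Then every $e_n$ is finite, and there is a (unique) real number $\mu = \mu_p$, the Hilbert-Kunz multiplicity of $h$, such that $e_n = \mu q^{s-1} + O(q^{s-2})$ as $n \to \infty$ with $p$ fixed. As $p \to \infty$ through the primes, $$\mu_p \longrightarrow 1 + \bigl(\text{the coefficient of } z^{s-1} \text{ in the power series expansion of } \sec z + \tan z \text{ at } z=0\bigr).$$ -/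

import Mathlib

open Filter Topology Asymptotics MvPolynomial

/-- The ideal of `(ℤ/p)[x₁, …, x_s]` generated by `h` and the powers `x_i ^ (p ^ n)`. -/
noncomputable def frobeniusIdeal {s p : ℕ} (h : MvPolynomial (Fin s) (ZMod p)) (n : ℕ) :
    Ideal (MvPolynomial (Fin s) (ZMod p)) :=
  Ideal.span (insert h (Set.range fun i : Fin s => (X i : MvPolynomial (Fin s) (ZMod p)) ^ p ^ n))

/-- `m` is the Hilbert-Kunz multiplicity of `h` (for `s ≥ 2` and `p` prime): writing `e n` for the
colength of the ideal generated by `h` and the `x_i ^ q`, where `q = p ^ n`, the colengths `e n` are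
finite and `e n = m * q ^ (s - 1) + O(q ^ (s - 2))` as `n → ∞`. -/
def IsHilbertKunzMultiplicity {s p : ℕ} (h : MvPolynomial (Fin s) (ZMod p)) (m : ℝ) : Prop :=
  ∃ e : ℕ → ℕ,
    (∀ n, Module.length (MvPolynomial (Fin s) (ZMod p))
      (MvPolynomial (Fin s) (ZMod p) ⧸ frobeniusIdeal h n) = e n) ∧
    (fun n => (e n : ℝ) - m * ((p : ℝ) ^ n) ^ (s - 1)) =O[atTop]
      fun n => ((p : ℝ) ^ n) ^ (s - 2)

/-- There is at most one Hilbert-Kunz multiplicity. -/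
theorem IsHilbertKunzMultiplicity.unique {s p : ℕ} (hs : 2 ≤ s) (hp : p.Prime)
    {h : MvPolynomial (Fin s) (ZMod p)} {m m' : ℝ}
    (hm : IsHilbertKunzMultiplicity h m) (hm' : IsHilbertKunzMultiplicity h m') : m = m' := by
  obtain ⟨e, he, hO⟩ := hm
  obtain ⟨e', he', hO'⟩ := hm'
  obtain rfl : e = e' := funext fun n => by
    have := (he n).symm.trans (he' n)
    exact_mod_cast this
  have hp1 : (1 : ℝ) < p := by exact_mod_cast hp.one_lt
  have hq : Tendsto (fun n : ℕ => (p : ℝ) ^ n) atTop atTop := tendsto_pow_atTop_atTop_of_one_lt hp1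
  have hlit : (fun n : ℕ => ((p : ℝ) ^ n) ^ (s - 2)) =o[atTop]
      fun n : ℕ => ((p : ℝ) ^ n) ^ (s - 1) :=
    (isLittleO_pow_pow_atTop_of_lt (𝕜 := ℝ) (show s - 2 < s - 1 by omega)).comp_tendsto hq
  have h1 : (fun n : ℕ => (m' - m) * ((p : ℝ) ^ n) ^ (s - 1)) =o[atTop]
      fun n : ℕ => ((p : ℝ) ^ n) ^ (s - 1) := by
    refine ((hO.sub hO').trans_isLittleO hlit).congr_left fun n => ?_
    ring
  by_contra hne
  have hc : m' - m ≠ 0 := sub_ne_zero.mpr (Ne.symm hne)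
  rw [isLittleO_const_mul_left_iff hc] at h1
  have h2 := isLittleO_irrefl' (l := (atTop : Filter ℕ))
    (f' := fun n : ℕ => ((p : ℝ) ^ n) ^ (s - 1)) (Frequently.of_forall fun n =>
      norm_ne_zero_iff.mpr (by positivity))
  exact h2 h1

/-- The coefficient of `z ^ n` in the power series (Taylor) expansion of `sec z + tan z` at `0`. -/
noncomputable def secTanCoeff (n : ℕ) : ℝ :=
  iteratedDeriv n (fun z : ℝ => (Real.cos z)⁻¹ + Real.tan z) 0 / (n.factorial : ℝ)

/-! Write s = r + 2 and let S(m) be the dimension of k[x]/(x_i^m, Σ x_i), which is `sumDim`. Since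
k[x] is free of rank 2^s over k[x_1^2, …, x_s^2], the ideal (x_i^(2m), Σ x_i^2) has colength 2^s
S(m), so e_n lies between the values of this for m = ⌊q/2⌋ and m = ⌊q/2⌋ + 1. Eliminating a variable
turns S(m) into the dimension of k[x_1, …, x_(s-1)]/(x_i^m, (Σ x_i)^m), and Frobenius then gives
S(pm) = p^(s-1) S(m) (`sumDim_mul_char`). Together with the growth bound `sumDim_add_le`, this makes
u_n = 2^s S(⌊p^n/2⌋)/p^(n(s-1)) increase to a limit μ_p with μ_p - u_n ≤ 2C/p^n, where C depends
only on s. Hence μ_p = u_1 + O(1/p), and only S(⌊p/2⌋) has to be computed.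

For exponents at most p, the dimension of k[x]/(x_i^(a_i), (Σ x_i)^c) satisfies a discrete wave
equation in each pair (a_i, c), with a degenerate form at c = p (`powDim_wave`,
`powDim_wave_boundary`). Chebyshev polynomials separate the variables and give a sum over the angles
jπ/p (`powDim_eq_sum`).

As p → ∞, dominated convergence turns u_1 into 1 + Σ_{j≥1} 2 (2 sin(jπ/2)/(jπ))^s
(`tendsto_sum_normTerm`). The nonzero terms come from the poles of sec z + tan z = cot(π/4 - z/2):
its partial fractions, expanded in geometric series, show that the sum over j is the coefficient of
z^(s-1) (`secTanCoeff_eq`, `tsum_sin_eq_secTanPoleSum`). -/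

section Colength

variable {k : Type*} [Field k]

/-- The dimension over `k` of the quotient of a `k`-algebra by an ideal. -/
noncomputable def kdim (k : Type*) [Field k] {A : Type*} [CommRing A] [Algebra k A] (I : Ideal A) :
    ℕ∞ :=
  Module.length k (A ⧸ I)

/-! ### Subadditivity of colengths. -/

section General

variable {A : Type*} [CommRing A] [Algebra k A]

theorem kdim_anti {I J : Ideal A} (h : I ≤ J) : kdim k J ≤ kdim k I :=
  Module.length_le_of_surjective (Ideal.Quotient.factorₐ k h).toLinearMap
    (Ideal.Quotient.factor_surjective h)

theorem kdim_top : kdim k (⊤ : Ideal A) = 0 := by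
  have : Subsingleton (A ⧸ (⊤ : Ideal A)) := Ideal.Quotient.subsingleton_iff.mpr rfl
  exact Module.length_eq_zero

theorem length_le_kdim {V : Type*} [AddCommGroup V] [Module k V] (I : Ideal A) (f : A →ₗ[k] V)
    (hf : Function.Surjective f) (hI : ∀ x ∈ I, f x = 0) : Module.length k V ≤ kdim k I := by
  let g : (A ⧸ I.restrictScalars k) →ₗ[k] V := Submodule.liftQ _ f hI
  have hg : Function.Surjective g := fun v => by
    obtain ⟨x, rfl⟩ := hf v
    exact ⟨Submodule.Quotient.mk x, rfl⟩
  exact Module.length_le_of_surjective g hg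

/-- Multiplication by `u` maps A/(I, v) onto the kernel of A/(I, uv) → A/(I, u). -/
theorem kdim_sup_span_mul_le (I : Ideal A) (u v : A) :
    kdim k (I ⊔ Ideal.span {u * v}) ≤ kdim k (I ⊔ Ideal.span {u}) + kdim k (I ⊔ Ideal.span {v}) := by
  have hJu : I ⊔ Ideal.span {u * v} ≤ I ⊔ Ideal.span {u} :=
    sup_le_sup_left (Ideal.span_singleton_le_span_singleton.mpr (Dvd.intro _ rfl)) _
  obtain ⟨J, hJ⟩ : ∃ J, J = I ⊔ Ideal.span {u * v} := ⟨_, rfl⟩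
  rw [← hJ] at hJu ⊢
  have hIJ : I ≤ J := hJ ▸ le_sup_left
  have huv : u * v ∈ J := hJ ▸ Ideal.mem_sup_right (Ideal.mem_span_singleton_self _)
  let g : (A ⧸ J) →ₗ[k] (A ⧸ (I ⊔ Ideal.span {u})) := (Ideal.Quotient.factorₐ k hJu).toLinearMap
  have hg : Function.Surjective g := Ideal.Quotient.factor_surjective hJu
  have hgmk : ∀ x : A, g (Ideal.Quotient.mk J x) = Ideal.Quotient.mk _ x := fun x => rfl
  rw [kdim, Module.length_eq_add_of_exact (LinearMap.ker g).subtype g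
    (Submodule.subtype_injective _) hg (LinearMap.exact_subtype_ker_map g), add_comm]
  refine add_le_add le_rfl ?_
  let m : A →ₗ[k] (A ⧸ J) := (Ideal.Quotient.mkₐ k J).toLinearMap ∘ₗ LinearMap.mulLeft k u
  have hm : ∀ x, m x = Ideal.Quotient.mk J (u * x) := fun x => rfl
  have hmg : ∀ x, m x ∈ LinearMap.ker g := fun x => by
    rw [LinearMap.mem_ker, hm, hgmk]
    exact Ideal.Quotient.eq_zero_iff_mem.mpr
      (Ideal.mem_sup_right (Ideal.mul_mem_right _ _ (Ideal.mem_span_singleton_self _)))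
  refine length_le_kdim _ (m.codRestrict (LinearMap.ker g) hmg) ?_ ?_
  · rintro ⟨x, hx⟩
    obtain ⟨x, rfl⟩ := Ideal.Quotient.mk_surjective x
    rw [LinearMap.mem_ker, hgmk, Ideal.Quotient.eq_zero_iff_mem] at hx
    obtain ⟨i, hi, y, hy, rfl⟩ := Submodule.mem_sup.mp hx
    obtain ⟨z, rfl⟩ := Ideal.mem_span_singleton'.mp hy
    refine ⟨z, Subtype.ext ?_⟩
    rw [LinearMap.codRestrict_apply, hm, Ideal.Quotient.mk_eq_mk_iff_sub_mem]
    have : u * z - (i + z * u) = -i := by ring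
    rw [this]
    exact J.neg_mem (hIJ hi)
  · intro x hx
    obtain ⟨i, hi, y, hy, rfl⟩ := Submodule.mem_sup.mp hx
    obtain ⟨z, rfl⟩ := Ideal.mem_span_singleton'.mp hy
    refine Subtype.ext ?_
    rw [LinearMap.codRestrict_apply, hm]
    refine Ideal.Quotient.eq_zero_iff_mem.mpr ?_
    have : u * (i + z * v) = u * i + z * (u * v) := by ring
    rw [this]
    exact J.add_mem (hIJ (I.mul_mem_left _ hi)) (J.mul_mem_left _ huv)

theorem kdim_sup_span_pow_le (I : Ideal A) (u : A) (a t : ℕ) :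
    kdim k (I ⊔ Ideal.span {u ^ (a + t)}) ≤
      kdim k (I ⊔ Ideal.span {u ^ a}) + t * kdim k (I ⊔ Ideal.span {u}) := by
  induction t with
  | zero => simp
  | succ t ih =>
    rw [← add_assoc, pow_succ]
    refine (kdim_sup_span_mul_le _ _ _).trans ?_
    push_cast
    rw [add_mul, one_mul, ← add_assoc]
    gcongr

theorem kdim_comap_of_surjective {B : Type*} [CommRing B] [Algebra k B] (f : A →ₐ[k] B)
    (hf : Function.Surjective f) (J : Ideal B) : kdim k (J.comap f) = kdim k J := by
  let g : A →ₗ[k] (B ⧸ J) := (Ideal.Quotient.mkₐ k J).toLinearMap ∘ₗ f.toLinearMap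
  have hg : Function.Surjective g := (Ideal.Quotient.mk_surjective (I := J)).comp hf
  have hker : LinearMap.ker g = (J.comap f).restrictScalars k := by
    ext x
    exact Ideal.Quotient.eq_zero_iff_mem
  have e := g.quotKerEquivOfSurjective hg
  rw [hker] at e
  exact e.length_eq

end General

/-! ### Length over the polynomial ring against dimension over the field. -/

section MvPoly

variable {σ : Type*}

/-- Polynomials act through their constant terms, so submodules and subspaces coincide. -/
theorem length_eq_length_of_forall_X_smul_eq_zero {M : Type*} [AddCommGroup M] [Module k M]
    [Module (MvPolynomial σ k) M] [IsScalarTower k (MvPolynomial σ k) M]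
    (h : ∀ f ∈ Ideal.span (Set.range (X : σ → MvPolynomial σ k)), ∀ x : M, f • x = 0) :
    Module.length (MvPolynomial σ k) M = Module.length k M := by
  have key : ∀ (f : MvPolynomial σ k) (x : M), f • x = constantCoeff f • x := by
    intro f x
    have hf : f - C (constantCoeff f) ∈ Ideal.span (Set.range (X : σ → MvPolynomial σ k)) := by
      rw [← Set.image_univ, mem_ideal_span_X_image]
      intro m hm
      by_contra! hcon
      have hm0 : m = 0 := by
        ext i
        exact hcon i (Set.mem_univ i)
      rw [mem_support_iff, hm0] at hm
      simp [constantCoeff_eq] at hm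
    have h1 := h _ hf x
    rw [sub_smul, sub_eq_zero] at h1
    rw [h1, ← algebraMap_eq, algebraMap_smul]
  refine le_antisymm ?_ ?_
  · rw [← WithBot.coe_le_coe, Module.coe_length, Module.coe_length]
    exact Order.krullDim_le_of_strictMono
      (fun N : Submodule (MvPolynomial σ k) M => N.restrictScalars k) fun _ _ h => h
  · rw [← WithBot.coe_le_coe, Module.coe_length, Module.coe_length]
    exact Order.krullDim_le_of_strictMono
      (fun N : Submodule k M => (⟨N.toAddSubmonoid, fun f x hx => by
        rw [key]; exact N.smul_mem _ hx⟩ : Submodule (MvPolynomial σ k) M)) fun _ _ h => h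

/-- Dévissage along 0 → IM → M → M/IM → 0, with I the ideal of the variables. -/
theorem length_eq_length_of_pow_smul_eq_zero (N : ℕ) {M : Type*} [AddCommGroup M] [Module k M]
    [Module (MvPolynomial σ k) M] [IsScalarTower k (MvPolynomial σ k) M]
    (h : ∀ f ∈ Ideal.span (Set.range (X : σ → MvPolynomial σ k)) ^ N, ∀ x : M, f • x = 0) :
    Module.length (MvPolynomial σ k) M = Module.length k M := by
  induction N generalizing M with
  | zero =>
    have : Subsingleton M := ⟨fun x y => by
      rw [← one_smul (MvPolynomial σ k) x, ← one_smul (MvPolynomial σ k) y, h 1 (by simp),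
        h 1 (by simp)]⟩
    simp
  | succ N ih =>
    let I := Ideal.span (Set.range (X : σ → MvPolynomial σ k))
    let S : Submodule (MvPolynomial σ k) M := I • ⊤
    have h1 : Module.length (MvPolynomial σ k) S = Module.length k S := by
      refine ih ?_
      rintro f hf ⟨x, hx⟩
      refine Subtype.ext ?_
      change f • x = 0
      refine Submodule.smul_induction_on hx (fun r hr n _ => ?_) fun x y hx hy => ?_
      · rw [← mul_smul]
        exact h _ (by rw [pow_succ]; exact Ideal.mul_mem_mul hf hr) n
      · rw [smul_add, hx, hy, add_zero]
    have h2 : Module.length (MvPolynomial σ k) (M ⧸ S) = Module.length k (M ⧸ S) := by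
      refine length_eq_length_of_forall_X_smul_eq_zero ?_
      intro f hf x
      obtain ⟨x, rfl⟩ := S.mkQ_surjective x
      rw [← map_smul]
      exact (Submodule.Quotient.mk_eq_zero S).mpr (Submodule.smul_mem_smul hf trivial)
    rw [Module.length_eq_add_of_exact S.subtype S.mkQ S.subtype_injective S.mkQ_surjective
      (LinearMap.exact_subtype_mkQ S), h1, h2]
    exact (Module.length_eq_add_of_exact (S.subtype.restrictScalars k) (S.mkQ.restrictScalars k)
      S.subtype_injective S.mkQ_surjective (LinearMap.exact_subtype_mkQ S)).symm

end MvPoly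

end Colength

/-! ### The wave equation, from an automorphism of the dual numbers A[ε]. -/

section DualNumbers

variable {k : Type*} [Field k] {A : Type*} [CommRing A] [Algebra k A]

/-- For an ideal `I` of `A`, this is the ideal of `A[ε]` generated by `I` and `w + w' ε`, written
as a subspace of `A × A`. -/
def dualSpan (k : Type*) [Field k] {A : Type*} [CommRing A] [Algebra k A] (I : Ideal A)
    (w w' : A) : Submodule k (A × A) where
  carrier := {x | ∃ a e, x.1 - w * a ∈ I ∧ x.2 - (w * e + w' * a) ∈ I}
  add_mem' := by
    rintro ⟨u, v⟩ ⟨u', v'⟩ ⟨a, e, h1, h2⟩ ⟨a', e', h1', h2'⟩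
    refine ⟨a + a', e + e', ?_, ?_⟩
    · convert I.add_mem h1 h1' using 1
      simp only [Prod.mk_add_mk]
      ring
    · convert I.add_mem h2 h2' using 1
      simp only [Prod.mk_add_mk]
      ring
  zero_mem' := ⟨0, 0, by simp, by simp⟩
  smul_mem' := by
    rintro c ⟨u, v⟩ ⟨a, e, h1, h2⟩
    refine ⟨c • a, c • e, ?_, ?_⟩
    · change c • u - w * (c • a) ∈ I
      rw [mul_smul_comm, ← smul_sub]
      exact I.smul_of_tower_mem c h1
    · change c • v - (w * (c • e) + w' * (c • a)) ∈ I
      rw [mul_smul_comm, mul_smul_comm, ← smul_add, ← smul_sub]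
      exact I.smul_of_tower_mem c h2

theorem mem_dualSpan {I : Ideal A} {w w' u v : A} :
    (u, v) ∈ dualSpan k I w w' ↔ ∃ a e, u - w * a ∈ I ∧ v - (w * e + w' * a) ∈ I := Iff.rfl

theorem length_eq_kdim_add_kdim (S : Submodule k (A × A)) (J₁ J₂ : Ideal A) (f : A × A →ₗ[k] A × A)
    (hf : Function.Surjective f) (h : ∀ x, x ∈ S ↔ (f x).1 ∈ J₁ ∧ (f x).2 ∈ J₂) :
    Module.length k ((A × A) ⧸ S) = kdim k J₁ + kdim k J₂ := by
  let g : A × A →ₗ[k] (A ⧸ J₁) × (A ⧸ J₂) :=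
    ((Ideal.Quotient.mkₐ k J₁).toLinearMap.prodMap (Ideal.Quotient.mkₐ k J₂).toLinearMap) ∘ₗ f
  have hg : Function.Surjective g :=
    (Function.Surjective.prodMap Ideal.Quotient.mk_surjective Ideal.Quotient.mk_surjective).comp hf
  have hker : LinearMap.ker g = S := by
    ext x
    rw [h, LinearMap.mem_ker, Prod.ext_iff]
    exact and_congr Ideal.Quotient.eq_zero_iff_mem Ideal.Quotient.eq_zero_iff_mem
  rw [← hker, (g.quotKerEquivOfSurjective hg).length_eq, Module.length_prod]
  rfl

/-- As γ is a unit, (γu - yv, v) are coordinates on A × A. In them the ideal of y^(c+1) + γ y^c ε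
becomes the product of (I, y^(c+2)) and (I, y^c). -/
theorem length_quotient_dualSpan (I : Ideal A) (y : A) (c : ℕ) {γ : k} (hγ : γ ≠ 0) :
    Module.length k ((A × A) ⧸ dualSpan k I (y ^ (c + 1)) (algebraMap k A γ * y ^ c)) =
      kdim k (I ⊔ Ideal.span {y ^ (c + 2)}) + kdim k (I ⊔ Ideal.span {y ^ c}) := by
  obtain ⟨g, hg⟩ : ∃ g, g = algebraMap k A γ := ⟨_, rfl⟩
  obtain ⟨g', hg'⟩ : ∃ g', g * g' = 1 :=
    ⟨algebraMap k A γ⁻¹, by rw [hg, ← map_mul, mul_inv_cancel₀ hγ, map_one]⟩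
  rw [← hg]
  let f : A × A →ₗ[k] A × A :=
    ((LinearMap.mulLeft k g).comp (LinearMap.fst k A A) -
      (LinearMap.mulLeft k y).comp (LinearMap.snd k A A)).prod (LinearMap.snd k A A)
  have hf : ∀ u v, f (u, v) = (g * u - y * v, v) := fun u v => rfl
  refine length_eq_kdim_add_kdim _ _ _ f ?_ ?_
  · rintro ⟨u, v⟩
    refine ⟨(g' * (u + y * v), v), ?_⟩
    rw [hf]
    ext
    · change g * (g' * (u + y * v)) - y * v = u
      linear_combination (u + y * v) * hg'
    · rfl
  · rintro ⟨u, v⟩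
    rw [mem_dualSpan, hf]
    constructor
    · rintro ⟨a, e, h1, h2⟩
      constructor
      · refine Submodule.mem_sup.mpr ⟨g * (u - y ^ (c + 1) * a) -
          y * (v - (y ^ (c + 1) * e + g * y ^ c * a)),
          I.sub_mem (I.mul_mem_left _ h1) (I.mul_mem_left _ h2), -e * y ^ (c + 2),
          Ideal.mem_span_singleton'.mpr ⟨_, rfl⟩, ?_⟩
        ring
      · refine Submodule.mem_sup.mpr ⟨_, h2, (y * e + g * a) * y ^ c,
          Ideal.mem_span_singleton'.mpr ⟨_, rfl⟩, ?_⟩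
        ring
    · rintro ⟨h1, h2⟩
      obtain ⟨i, hi, x, hx, h1⟩ := Submodule.mem_sup.mp h1
      obtain ⟨z', rfl⟩ := Ideal.mem_span_singleton'.mp hx
      obtain ⟨j, hj, x', hx', h2⟩ := Submodule.mem_sup.mp h2
      obtain ⟨z, rfl⟩ := Ideal.mem_span_singleton'.mp hx'
      simp only at h1 h2
      refine ⟨g' * (z + y * z'), -z', ?_, ?_⟩
      · have : u - y ^ (c + 1) * (g' * (z + y * z')) = g' * i + g' * y * j := by
          linear_combination (-u) * hg' - g' * h1 - g' * y * h2
        rw [this]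
        exact I.add_mem (I.mul_mem_left _ hi) (I.mul_mem_left _ hj)
      · have : v - (y ^ (c + 1) * -z' + g * y ^ c * (g' * (z + y * z'))) = j := by
          linear_combination (-y ^ c * (z + y * z')) * hg' - h2
        rw [this]
        exact hj

theorem length_quotient_dualSpan_zero (I : Ideal A) (w : A) :
    Module.length k ((A × A) ⧸ dualSpan k I w 0) = 2 * kdim k (I ⊔ Ideal.span {w}) := by
  rw [two_mul]
  refine length_eq_kdim_add_kdim _ _ _ LinearMap.id Function.surjective_id ?_
  have key : ∀ u : A, (∃ a, u - w * a ∈ I) ↔ u ∈ I ⊔ Ideal.span {w} := by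
    intro u
    constructor
    · rintro ⟨a, ha⟩
      exact Submodule.mem_sup.mpr ⟨_, ha, a * w, Ideal.mem_span_singleton'.mpr ⟨a, rfl⟩, by ring⟩
    · intro h
      obtain ⟨i, hi, x, hx, h⟩ := Submodule.mem_sup.mp h
      obtain ⟨z, rfl⟩ := Ideal.mem_span_singleton'.mp hx
      exact ⟨z, by rw [← h]; convert hi using 1; ring⟩
  rintro ⟨u, v⟩
  simp only [mem_dualSpan, zero_mul, add_zero, LinearMap.id_coe, id_eq, ← key]
  exact ⟨fun ⟨a, e, h⟩ => ⟨⟨a, h.1⟩, ⟨e, h.2⟩⟩, fun ⟨⟨a, h⟩, ⟨e, h'⟩⟩ => ⟨a, e, h, h'⟩⟩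

/-- The map u + vε ↦ u + (v + Du)ε is the ring automorphism exp(εD). It preserves I and shifts `x`
and `y` by δε, so it sends (I, x^(b+1), (y - δε)^(c+1)) into (I, (x + δε)^(b+1), y^(c+1)). -/
theorem add_derivation_mem_dualSpan {I : Ideal A} {D : Derivation k A A}
    (hD : ∀ f ∈ I, D f ∈ I) {x y δ : A} (hx : D x = δ) (hy : D y = δ) (b c : ℕ) {u v : A}
    (h : (u, v) ∈ dualSpan k (I ⊔ Ideal.span {x ^ (b + 1)}) (y ^ (c + 1))
      (-δ * ((c + 1 : ℕ) : A) * y ^ c)) :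
    (u, v + D u) ∈ dualSpan k (I ⊔ Ideal.span {y ^ (c + 1)}) (x ^ (b + 1))
      (δ * ((b + 1 : ℕ) : A) * x ^ b) := by
  obtain ⟨a, e, h1, h2⟩ := h
  obtain ⟨i, hi, z, hz, h1⟩ := Submodule.mem_sup.mp h1
  obtain ⟨u₁, rfl⟩ := Ideal.mem_span_singleton'.mp hz
  obtain ⟨j, hj, z', hz', h2⟩ := Submodule.mem_sup.mp h2
  obtain ⟨v₁, rfl⟩ := Ideal.mem_span_singleton'.mp hz'
  simp only at h1 h2
  have hu : u = i + u₁ * x ^ (b + 1) + y ^ (c + 1) * a := by linear_combination -h1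
  have hDu : D u = D i + (D u₁ * x ^ (b + 1) + u₁ * (((b + 1 : ℕ) : A) * x ^ b * δ)) +
      (y ^ (c + 1) * D a + a * (((c + 1 : ℕ) : A) * y ^ c * δ)) := by
    rw [hu]
    simp only [map_add, Derivation.leibniz, Derivation.leibniz_pow, hx, hy, smul_eq_mul,
      nsmul_eq_mul, Nat.add_sub_cancel]
    push_cast
    ring
  refine mem_dualSpan.mpr ⟨u₁, v₁ + D u₁, ?_, ?_⟩
  · refine Submodule.mem_sup.mpr ⟨i, hi, a * y ^ (c + 1), Ideal.mem_span_singleton'.mpr ⟨_, rfl⟩, ?_⟩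
    rw [hu]
    ring
  · refine Submodule.mem_sup.mpr ⟨j + D i, I.add_mem hj (hD i hi), (e + D a) * y ^ (c + 1),
      Ideal.mem_span_singleton'.mpr ⟨_, rfl⟩, ?_⟩
    rw [hDu]
    linear_combination h2

theorem length_quotient_dualSpan_swap {I : Ideal A} {D : Derivation k A A}
    (hD : ∀ f ∈ I, D f ∈ I) {x y : A} (hx : D x = 1) (hy : D y = 1) (b c : ℕ) :
    Module.length k ((A × A) ⧸ dualSpan k (I ⊔ Ideal.span {x ^ (b + 1)}) (y ^ (c + 1))
      (algebraMap k A (-((c + 1 : ℕ) : k)) * y ^ c)) =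
    Module.length k ((A × A) ⧸ dualSpan k (I ⊔ Ideal.span {y ^ (c + 1)}) (x ^ (b + 1))
      (algebraMap k A ((b + 1 : ℕ) : k) * x ^ b)) := by
  let f : A × A →ₗ[k] A × A :=
    (LinearMap.fst k A A).prod (LinearMap.snd k A A + (D : A →ₗ[k] A).comp (LinearMap.fst k A A))
  let g : A × A →ₗ[k] A × A :=
    (LinearMap.fst k A A).prod (LinearMap.snd k A A - (D : A →ₗ[k] A).comp (LinearMap.fst k A A))
  let e : (A × A) ≃ₗ[k] (A × A) := LinearEquiv.ofLinearMap f g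
    (by ext <;> simp [f, g]) (by ext <;> simp [f, g])
  have he : ∀ u v, e (u, v) = (u, v + D u) := fun u v => rfl
  have he' : ∀ u v, e.symm (u, v) = (u, v - D u) := fun u v => rfl
  refine (Submodule.Quotient.equiv _ _ e ?_).length_eq
  ext ⟨u, v⟩
  rw [Submodule.mem_map_equiv, he']
  constructor
  · intro h
    have := add_derivation_mem_dualSpan (k := k) hD hx hy b c (u := u) (v := v - D u)
      (by simpa using h)
    simpa using this
  · intro h
    -- The opposite inclusion is the same lemma for exp(-εD) with `x` and `y` exchanged, hence the
    -- sign parameter δ.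
    have := add_derivation_mem_dualSpan (k := k) (D := -D) (x := y) (y := x) (δ := -1)
      (fun f hf => by simpa using hD f hf)
      (by simp [hy]) (by simp [hx]) c b (u := u) (v := v) (by simpa using h)
    simpa [sub_eq_add_neg] using this

/-- If a derivation preserves `I` and takes the value `1` at `x` and at `y`, the dimensions of
`A / (I, x ^ b, y ^ c)` satisfy a discrete wave equation. -/
theorem kdim_wave {I : Ideal A} {D : Derivation k A A}
    (hD : ∀ f ∈ I, D f ∈ I) {x y : A} (hx : D x = 1) (hy : D y = 1) {b c : ℕ}
    (hb : ((b + 1 : ℕ) : k) ≠ 0) (hc : ((c + 1 : ℕ) : k) ≠ 0) :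
    kdim k (I ⊔ Ideal.span {x ^ (b + 2)} ⊔ Ideal.span {y ^ (c + 1)}) +
      kdim k (I ⊔ Ideal.span {x ^ b} ⊔ Ideal.span {y ^ (c + 1)}) =
    kdim k (I ⊔ Ideal.span {x ^ (b + 1)} ⊔ Ideal.span {y ^ (c + 2)}) +
      kdim k (I ⊔ Ideal.span {x ^ (b + 1)} ⊔ Ideal.span {y ^ c}) := by
  -- Each side is the dimension of a quotient of A[ε], by (y - ε)^(c+1) on one side and by (x +
  -- ε)^(b+1) on the other; exp(εD) identifies the two.
  rw [← length_quotient_dualSpan _ y c (neg_ne_zero.mpr hc), length_quotient_dualSpan_swap hD hx hy,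
    length_quotient_dualSpan _ x b hb, sup_right_comm I (Ideal.span {x ^ (b + 2)}),
    sup_right_comm I (Ideal.span {x ^ b})]

/-- If c + 1 vanishes in `k`, then (y - ε)^(c+1) = y^(c+1), and that side is two copies of one
quotient. -/
theorem kdim_wave_boundary {I : Ideal A} {D : Derivation k A A}
    (hD : ∀ f ∈ I, D f ∈ I) {x y : A} (hx : D x = 1) (hy : D y = 1) {b c : ℕ}
    (hb : ((b + 1 : ℕ) : k) ≠ 0) (hc : ((c + 1 : ℕ) : k) = 0) :
    kdim k (I ⊔ Ideal.span {x ^ (b + 2)} ⊔ Ideal.span {y ^ (c + 1)}) +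
      kdim k (I ⊔ Ideal.span {x ^ b} ⊔ Ideal.span {y ^ (c + 1)}) =
    2 * kdim k (I ⊔ Ideal.span {x ^ (b + 1)} ⊔ Ideal.span {y ^ (c + 1)}) := by
  have h := length_quotient_dualSpan_swap hD hx hy b c
  rw [hc, neg_zero, map_zero, zero_mul, length_quotient_dualSpan_zero,
    length_quotient_dualSpan _ x b hb] at h
  rw [h, sup_right_comm I (Ideal.span {x ^ (b + 2)}),
    sup_right_comm I (Ideal.span {x ^ b})]

end DualNumbers

/-! ### Ideals of powers of the variables, and freeness of k[x] over k[x^m]. -/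

section MonomialIdeals

variable {k : Type*} [Field k] {σ : Type*}

/-- The ideal of `k[x_i]` generated by the powers `x_i ^ a_i`. -/
noncomputable def powIdeal (k : Type*) [Field k] {σ : Type*} (a : σ → ℕ) :
    Ideal (MvPolynomial σ k) :=
  Ideal.span (Set.range fun i => X i ^ a i)

/-- The sum of the variables. -/
noncomputable def sumX (k : Type*) [Field k] (σ : Type*) [Fintype σ] : MvPolynomial σ k := ∑ i, X i

theorem X_pow_mem_powIdeal (a : σ → ℕ) (i : σ) :
    (X i ^ a i : MvPolynomial σ k) ∈ powIdeal k a :=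
  Ideal.subset_span ⟨i, rfl⟩

theorem powIdeal_le_iff {a : σ → ℕ} {I : Ideal (MvPolynomial σ k)} :
    powIdeal k a ≤ I ↔ ∀ i, (X i ^ a i : MvPolynomial σ k) ∈ I := by
  rw [powIdeal, Ideal.span_le, Set.range_subset_iff]
  rfl

theorem powIdeal_anti {a b : σ → ℕ} (h : a ≤ b) : powIdeal k b ≤ powIdeal k a :=
  powIdeal_le_iff.mpr fun i =>
    Ideal.mem_of_dvd _ (pow_dvd_pow _ (h i)) (X_pow_mem_powIdeal a i)

section Expand

variable [Fintype σ] (m : ℕ)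

/-- This is uniqueness of division with remainder by `m`, applied to each exponent. -/
theorem coeff_monomial_mul_expand (hm : 0 < m) (ε ε' : σ → Fin m) (n : σ →₀ ℕ)
    (g : MvPolynomial σ k) :
    coeff (m • n + Finsupp.equivFunOnFinite.symm fun i => (ε i : ℕ))
      (monomial (Finsupp.equivFunOnFinite.symm fun i => (ε' i : ℕ)) 1 * expand m g) =
      if ε' = ε then coeff n g else 0 := by
  classical
  induction g using MvPolynomial.induction_on' with
  | monomial n' c =>
    rw [expand_monomial, monomial_mul, one_mul, coeff_monomial, coeff_monomial, ← ite_and]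
    refine if_congr ?_ rfl rfl
    constructor
    · intro h
      have h' : ∀ i, (ε' i : ℕ) + m * n' i = m * n i + ε i := fun i => by
        simpa using DFunLike.congr_fun h i
      constructor
      · funext i
        have := congrArg (· % m) (h' i)
        simp only [Nat.add_mul_mod_self_left, Nat.mul_add_mod, Nat.mod_eq_of_lt (Fin.is_lt _)] at this
        exact Fin.ext this
      · ext i
        have := congrArg (· / m) (h' i)
        simpa [Nat.add_mul_div_left _ _ hm, Nat.mul_add_div hm,
          Nat.div_eq_of_lt (Fin.is_lt _)] using this
    · rintro ⟨rfl, rfl⟩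
      exact add_comm _ _
  | add p q hp hq =>
    rw [map_add, mul_add, coeff_add, hp, hq, coeff_add]
    split_ifs <;> simp

/-- The map `(f_ε) ↦ ∑ x^ε f_ε(x^m)`, where `0 ≤ ε_i < m`. -/
noncomputable def expandSum (k : Type*) [Field k] (σ : Type*) [Fintype σ] [DecidableEq σ] (m : ℕ) :
    ((σ → Fin m) → MvPolynomial σ k) →ₗ[k] MvPolynomial σ k :=
  ∑ ε : σ → Fin m, (LinearMap.mulLeft k
    (monomial (Finsupp.equivFunOnFinite.symm fun i => (ε i : ℕ)) (1 : k))) ∘ₗ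
    (expand m).toLinearMap ∘ₗ LinearMap.proj ε

variable [DecidableEq σ]

theorem expandSum_apply (f : (σ → Fin m) → MvPolynomial σ k) :
    expandSum k σ m f = ∑ ε : σ → Fin m,
      monomial (Finsupp.equivFunOnFinite.symm fun i => (ε i : ℕ)) (1 : k) * expand m (f ε) := by
  simp [expandSum]

theorem coeff_expandSum (hm : 0 < m) (f : (σ → Fin m) → MvPolynomial σ k) (ε : σ → Fin m)
    (n : σ →₀ ℕ) :
    coeff (m • n + Finsupp.equivFunOnFinite.symm fun i => (ε i : ℕ)) (expandSum k σ m f) =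
      coeff n (f ε) := by
  rw [expandSum_apply, coeff_sum]
  simp [coeff_monomial_mul_expand m hm]

theorem expandSum_injective (hm : 0 < m) : Function.Injective (expandSum k σ m) := by
  intro f g h
  funext ε
  ext n
  rw [← coeff_expandSum m hm, ← coeff_expandSum m hm, h]

theorem expandSum_surjective (hm : 0 < m) : Function.Surjective (expandSum k σ m) := by
  intro f
  induction f using MvPolynomial.induction_on' with
  | monomial d c =>
    let ε : σ → Fin m := fun i => ⟨d i % m, Nat.mod_lt _ hm⟩
    let n : σ →₀ ℕ := Finsupp.equivFunOnFinite.symm fun i => d i / m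
    refine ⟨Pi.single ε (monomial n c), ?_⟩
    rw [expandSum_apply, Finset.sum_eq_single ε (fun ε' _ h => by simp [Pi.single_eq_of_ne h])
      (by simp), Pi.single_eq_same, expand_monomial, monomial_mul, one_mul]
    congr 2
    ext i
    simp [ε, n, Nat.mod_add_div]
  | add p q hp hq =>
    obtain ⟨f, rfl⟩ := hp
    obtain ⟨g, rfl⟩ := hq
    exact ⟨f + g, map_add _ _ _⟩

theorem expandSum_mul_expand (f : (σ → Fin m) → MvPolynomial σ k) (g : MvPolynomial σ k) :
    expandSum k σ m f * expand m g = expandSum k σ m fun ε => f ε * g := by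
  simp only [expandSum_apply, Finset.sum_mul, map_mul, mul_assoc]

/-- The monomials x^ε with all ε_i < m form a basis of k[x] over k[x^m], so the extended ideal is a
direct sum of copies of `I`. -/
theorem expandSum_mem_map_iff (hm : 0 < m) (I : Ideal (MvPolynomial σ k))
    (f : (σ → Fin m) → MvPolynomial σ k) :
    expandSum k σ m f ∈ I.map (expand m) ↔ ∀ ε, f ε ∈ I := by
  constructor
  · intro h
    suffices H : ∀ x ∈ I.map (expand m), ∃ g : (σ → Fin m) → MvPolynomial σ k,
        expandSum k σ m g = x ∧ ∀ ε, g ε ∈ I by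
      obtain ⟨g, hg, hgI⟩ := H _ h
      rwa [← expandSum_injective m hm hg]
    intro x hx
    refine Submodule.span_induction ?_ ?_ ?_ ?_ hx
    · rintro _ ⟨i, hi, rfl⟩
      obtain ⟨f, hf⟩ := expandSum_surjective (k := k) (σ := σ) m hm 1
      refine ⟨fun ε => f ε * i, ?_, fun ε => I.mul_mem_left _ hi⟩
      rw [← expandSum_mul_expand, hf, one_mul]
    · exact ⟨0, map_zero _, fun ε => I.zero_mem⟩
    · rintro _ _ _ _ ⟨f, rfl, hf⟩ ⟨g, rfl, hg⟩
      exact ⟨f + g, map_add _ _ _, fun ε => I.add_mem (hf ε) (hg ε)⟩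
    · rintro a _ _ ⟨f, rfl, hf⟩
      -- The matrix `G` of multiplication by `a` in the basis x^ε.
      choose G hG using fun ε : σ → Fin m => expandSum_surjective (k := k) (σ := σ) m hm
        (a * monomial (Finsupp.equivFunOnFinite.symm fun i => (ε i : ℕ)) 1)
      refine ⟨∑ ε, fun ε' => G ε ε' * f ε, ?_, fun ε' => ?_⟩
      · rw [map_sum, expandSum_apply, smul_eq_mul, Finset.mul_sum]
        exact Finset.sum_congr rfl fun ε _ => by rw [← expandSum_mul_expand, hG, mul_assoc]
      · rw [Finset.sum_apply]
        exact I.sum_mem fun ε _ => I.mul_mem_left _ (hf ε)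
  · intro h
    rw [expandSum_apply]
    exact Ideal.sum_mem _ fun ε _ => Ideal.mul_mem_left _ _ (Ideal.mem_map_of_mem _ (h ε))

theorem kdim_map_expand (hm : 0 < m) (I : Ideal (MvPolynomial σ k)) :
    kdim k (I.map (expand m)) = m ^ Fintype.card σ * kdim k I := by
  let g : ((σ → Fin m) → MvPolynomial σ k) →ₗ[k] (MvPolynomial σ k ⧸ I.map (expand m)) :=
    (Ideal.Quotient.mkₐ k _).toLinearMap ∘ₗ expandSum k σ m
  have hg : Function.Surjective g :=
    Ideal.Quotient.mk_surjective.comp (expandSum_surjective m hm)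
  have hker : LinearMap.ker g = Submodule.pi Set.univ fun _ => I.restrictScalars k := by
    ext f
    rw [LinearMap.mem_ker, Submodule.mem_pi]
    simp only [Set.mem_univ, forall_const]
    exact Ideal.Quotient.eq_zero_iff_mem.trans (expandSum_mem_map_iff m hm I f)
  have e := g.quotKerEquivOfSurjective hg
  rw [hker] at e
  rw [kdim, ← e.length_eq, (Submodule.quotientPi _).length_eq, Module.length_pi]
  simp [kdim]
  rfl

end Expand

/-! ### Elimination of a variable by the linear relation Σ x_i = 0. -/

section Elimination

variable (k) in
/-- The `k`-algebra map `k[x_0, …, x_r] → k[x_1, …, x_r]` that sends `x_0` to `-∑ x_i`. -/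
noncomputable def elimHom (r : ℕ) : MvPolynomial (Fin (r + 1)) k →ₐ[k] MvPolynomial (Fin r) k :=
  aeval (Fin.cons (-sumX k (Fin r)) X)

@[simp]
theorem elimHom_X_zero (r : ℕ) : elimHom k r (X 0) = -sumX k (Fin r) := by simp [elimHom]

@[simp]
theorem elimHom_X_succ (r : ℕ) (i : Fin r) : elimHom k r (X i.succ) = X i := by simp [elimHom]

theorem elimHom_sumX (r : ℕ) : elimHom k r (sumX k _) = 0 := by
  simp [sumX, Fin.sum_univ_succ]

theorem elimHom_surjective (r : ℕ) : Function.Surjective (elimHom k r) := by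
  intro f
  refine ⟨rename Fin.succ f, ?_⟩
  rw [← AlgHom.comp_apply]
  have : (elimHom k r).comp (rename Fin.succ) = AlgHom.id k _ := by
    ext i
    simp
  rw [this]
  rfl

theorem comap_elimHom_bot_le (r : ℕ) :
    Ideal.comap (elimHom k r) ⊥ ≤ Ideal.span {sumX k (Fin (r + 1))} := by
  intro f hf
  have key : (Ideal.Quotient.mkₐ k (Ideal.span {sumX k (Fin (r + 1))})).comp
      ((rename Fin.succ).comp (elimHom k r)) = Ideal.Quotient.mkₐ k _ := by
    ext i
    refine Fin.cases ?_ (fun i => ?_) i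
    · simp only [AlgHom.comp_apply, elimHom_X_zero, Ideal.Quotient.mkₐ_eq_mk]
      rw [Ideal.Quotient.mk_eq_mk_iff_sub_mem, ← Ideal.neg_mem_iff]
      convert Ideal.mem_span_singleton_self (sumX k (Fin (r + 1))) using 1
      simp [sumX, Fin.sum_univ_succ]
    · simp
  have h := DFunLike.congr_fun key f
  have hf0 : elimHom k r f = 0 := hf
  rw [AlgHom.comp_apply, AlgHom.comp_apply, hf0, map_zero, map_zero] at h
  exact Ideal.Quotient.eq_zero_iff_mem.mp h.symm

/-- This puts the sum on the same footing as the variables: all generators become `m`-th powers, as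
Frobenius scaling requires. -/
theorem kdim_powIdeal_sup_sumX (r m : ℕ) :
    kdim k (powIdeal k (fun _ : Fin (r + 1) => m) ⊔ Ideal.span {sumX k (Fin (r + 1))}) =
      kdim k (powIdeal k (fun _ : Fin r => m) ⊔ Ideal.span {sumX k (Fin r) ^ m}) := by
  have h : Ideal.comap (elimHom k r) (powIdeal k (fun _ : Fin r => m) ⊔ Ideal.span {sumX k (Fin r) ^ m})
      = powIdeal k (fun _ : Fin (r + 1) => m) ⊔ Ideal.span {sumX k (Fin (r + 1))} := by
    have hmap : Ideal.map (elimHom k r)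
        (powIdeal k (fun _ : Fin (r + 1) => m) ⊔ Ideal.span {sumX k (Fin (r + 1))}) =
        powIdeal k (fun _ : Fin r => m) ⊔ Ideal.span {sumX k (Fin r) ^ m} := by
      refine le_antisymm ?_ (sup_le ?_ ?_)
      · rw [Ideal.map_le_iff_le_comap]
        refine sup_le (powIdeal_le_iff.mpr fun i => ?_) ?_
        · rw [Ideal.mem_comap, map_pow]
          refine Fin.cases ?_ (fun i => ?_) i
          · rw [elimHom_X_zero, neg_pow]
            exact Ideal.mul_mem_left _ _ (Ideal.mem_sup_right (Ideal.mem_span_singleton_self _))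
          · rw [elimHom_X_succ]
            exact Ideal.mem_sup_left (X_pow_mem_powIdeal (fun _ => m) i)
        · rw [Ideal.span_singleton_le_iff_mem, Ideal.mem_comap, elimHom_sumX]
          exact Ideal.zero_mem _
      · refine powIdeal_le_iff.mpr fun i => ?_
        rw [← elimHom_X_succ, ← map_pow]
        exact Ideal.mem_map_of_mem _
          (Ideal.mem_sup_left (X_pow_mem_powIdeal (fun _ => m) i.succ))
      · rw [Ideal.span_singleton_le_iff_mem, ← Ideal.unit_mul_mem_iff_mem _ (isUnit_one.neg.pow m),
          ← neg_pow, ← elimHom_X_zero, ← map_pow]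
        exact Ideal.mem_map_of_mem _ (Ideal.mem_sup_left (X_pow_mem_powIdeal (fun _ => m) 0))
    rw [← hmap, Ideal.comap_map_of_surjective _ (elimHom_surjective r)]
    exact sup_eq_left.mpr ((comap_elimHom_bot_le r).trans le_sup_right)
  rw [← h, kdim_comap_of_surjective _ (elimHom_surjective r)]

end Elimination

end MonomialIdeals

/-! ### Upper bounds for colengths. -/

section Bounds

variable {k : Type*} [Field k] {σ : Type*}

theorem powIdeal_eq_top {a : σ → ℕ} {i : σ} (h : a i = 0) : powIdeal k a = ⊤ := by
  rw [Ideal.eq_top_iff_one]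
  simpa [h] using X_pow_mem_powIdeal (k := k) a i

theorem kdim_powIdeal_one : kdim k (powIdeal k fun _ : σ => 1) = 1 := by
  let f : MvPolynomial σ k →ₐ[k] k := aeval fun _ => 0
  have hf : Function.Surjective f := fun c => ⟨C c, by simp [f]⟩
  have h : powIdeal k (fun _ : σ => 1) = Ideal.comap f ⊥ := by
    refine le_antisymm (powIdeal_le_iff.mpr fun i => ?_) fun g hg => ?_
    · simp [f]
    · have hg' : constantCoeff g = 0 := by
        have : f g = 0 := hg
        simpa [f, aeval_zero'] using this
      have : (Set.range fun i : σ => (X i ^ 1 : MvPolynomial σ k)) = X '' Set.univ := by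
        simp
      rw [powIdeal, this, mem_ideal_span_X_image]
      intro m hm
      by_contra! hcon
      have hm0 : m = 0 := by
        ext i
        exact hcon i (Set.mem_univ i)
      rw [mem_support_iff, hm0] at hm
      exact hm hg'
  rw [h, kdim_comap_of_surjective f hf, kdim]
  have e : (k ⧸ (⊥ : Ideal k)) ≃ₗ[k] k := (AlgEquiv.quotientBot k k).toLinearEquiv
  rw [e.length_eq, Module.length_eq_finrank]
  simp

variable [DecidableEq σ]

/-- The ideal generated by the powers `x_j ^ a_j` with `j ≠ i`. -/
noncomputable def powIdealErase (k : Type*) [Field k] {σ : Type*} (a : σ → ℕ) (i : σ) :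
    Ideal (MvPolynomial σ k) :=
  Ideal.span ((fun j => X j ^ a j) '' {i}ᶜ)

theorem powIdeal_update (a : σ → ℕ) (i : σ) (b : ℕ) :
    powIdeal k (Function.update a i b) = powIdealErase k a i ⊔ Ideal.span {X i ^ b} := by
  rw [powIdeal, powIdealErase, ← Ideal.span_union]
  congr 1
  ext f
  constructor
  · rintro ⟨j, rfl⟩
    by_cases hj : j = i
    · subst hj
      right
      simp
    · left
      exact ⟨j, hj, by simp [Function.update_of_ne hj]⟩
  · rintro (⟨j, hj, rfl⟩ | h)
    · exact ⟨j, by simp [Function.update_of_ne (show j ≠ i from hj)]⟩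
    · rw [Set.mem_singleton_iff] at h
      exact ⟨i, by simp [h]⟩

theorem kdim_powIdeal_update_add_le (a : σ → ℕ) (i : σ) (b t : ℕ) (J : Ideal (MvPolynomial σ k)) :
    kdim k (powIdeal k (Function.update a i (b + t)) ⊔ J) ≤
      kdim k (powIdeal k (Function.update a i b) ⊔ J) +
        t * kdim k (powIdeal k (Function.update a i 1) ⊔ J) := by
  simp only [powIdeal_update, pow_one, sup_right_comm _ _ J]
  exact kdim_sup_span_pow_le _ _ _ _

variable [Fintype σ]

theorem kdim_powIdeal_le (a : σ → ℕ) : kdim k (powIdeal k a) ≤ ∏ i, (a i : ℕ∞) := by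
  suffices H : ∀ (S : Finset σ) (a : σ → ℕ), (∀ i ∉ S, a i = 1) →
      kdim k (powIdeal k a) ≤ ∏ i ∈ S, (a i : ℕ∞) from H _ a (by simp)
  intro S
  induction S using Finset.induction_on with
  | empty =>
    intro a ha
    obtain rfl : a = fun _ => 1 := funext fun i => ha i (Finset.notMem_empty i)
    simp [kdim_powIdeal_one]
  | insert i S hi ih =>
    intro a ha
    -- Starting from exponent 0, where the ideal is the whole ring, bounds the dimension by `a i`
    -- times the one with x_i killed.
    have h := kdim_powIdeal_update_add_le (k := k) a i 0 (a i) ⊥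
    simp only [zero_add, Function.update_eq_self, sup_bot_eq] at h
    rw [powIdeal_eq_top (a := Function.update a i 0) (i := i) (by simp), kdim_top, zero_add] at h
    refine h.trans ?_
    rw [Finset.prod_insert hi]
    gcongr
    refine (ih _ fun j hj => ?_).trans (le_of_eq (Finset.prod_congr rfl fun j hj => ?_))
    · by_cases hji : j = i
      · simp [hji]
      · rw [Function.update_of_ne hji]
        exact ha j (by simp [hji, hj])
    · rw [Function.update_of_ne (ne_of_mem_of_not_mem hj hi)]

theorem kdim_powIdeal_sup_le (a : σ → ℕ) (J : Ideal (MvPolynomial σ k)) :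
    kdim k (powIdeal k a ⊔ J) ≤ ∏ i, (a i : ℕ∞) :=
  (kdim_anti le_sup_left).trans (kdim_powIdeal_le a)

theorem kdim_powIdeal_sup_ne_top (a : σ → ℕ) (J : Ideal (MvPolynomial σ k)) :
    kdim k (powIdeal k a ⊔ J) ≠ ⊤ := by
  refine ne_top_of_le_ne_top ?_ (kdim_powIdeal_sup_le a J)
  rw [← Nat.cast_prod]
  exact ENat.natCast_ne_top _

/-- The exponents are raised one variable at a time. Each unit costs at most a quotient in which
that variable is killed. -/
theorem kdim_powIdeal_const_add_le (m t : ℕ) (J : Ideal (MvPolynomial σ k)) :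
    kdim k (powIdeal k (fun _ : σ => m + t) ⊔ J) ≤
      kdim k (powIdeal k (fun _ : σ => m) ⊔ J) +
        (Fintype.card σ * t * (m + t) ^ (Fintype.card σ - 1) : ℕ) := by
  suffices H : ∀ S : Finset σ, kdim k (powIdeal k (fun i => if i ∈ S then m + t else m) ⊔ J) ≤
      kdim k (powIdeal k (fun _ : σ => m) ⊔ J) +
        (S.card * t * (m + t) ^ (Fintype.card σ - 1) : ℕ) by
    simpa using H Finset.univ
  intro S
  induction S using Finset.induction_on with
  | empty => simp
  | insert i S hi ih =>
    set a : σ → ℕ := fun i => if i ∈ S then m + t else m with ha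
    have h1 : (fun j => if j ∈ insert i S then m + t else m) = Function.update a i (m + t) := by
      funext j
      by_cases hj : j = i
      · simp [hj]
      · simp [hj, ha]
    have h2 : Function.update a i m = a := by
      rw [Function.update_eq_self_iff]
      simp [ha, hi]
    rw [h1]
    refine (kdim_powIdeal_update_add_le a i m t J).trans ?_
    rw [h2, Finset.card_insert_of_notMem hi]
    have h3 : kdim k (powIdeal k (Function.update a i 1) ⊔ J) ≤
        ((m + t) ^ (Fintype.card σ - 1) : ℕ) := by
      refine (kdim_powIdeal_sup_le _ J).trans ?_
      rw [← Nat.cast_prod, Nat.cast_le, ← Finset.mul_prod_erase _ _ (Finset.mem_univ i),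
        Function.update_self, one_mul, ← Finset.card_univ, ← Finset.card_erase_of_mem (Finset.mem_univ i)]
      refine Finset.prod_le_pow_card _ _ _ fun j hj => ?_
      rw [Function.update_of_ne (Finset.ne_of_mem_erase hj)]
      simp only [ha]
      split_ifs <;> omega
    refine (add_le_add ih (mul_le_mul_right h3 _)).trans (le_of_eq ?_)
    push_cast
    ring

end Bounds

/-! ### Growth and Frobenius scaling of `sumDim`. -/

section SumIdeal

variable {k : Type*} [Field k]

/-- The dimension of `k[x_1, …, x_s] / (x_1 ^ m, …, x_s ^ m, x_1 + ⋯ + x_s)`, for `s = r + 2`. -/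
noncomputable def sumDim (k : Type*) [Field k] (r m : ℕ) : ℕ :=
  (kdim k (powIdeal k (fun _ : Fin (r + 2) => m) ⊔ Ideal.span {sumX k (Fin (r + 2))})).toNat

theorem coe_sumDim (r m : ℕ) : (sumDim k r m : ℕ∞) =
    kdim k (powIdeal k (fun _ : Fin (r + 2) => m) ⊔ Ideal.span {sumX k (Fin (r + 2))}) :=
  ENat.natCast_toNat (kdim_powIdeal_sup_ne_top _ _)

theorem coe_sumDim' (r m : ℕ) : (sumDim k r m : ℕ∞) =
    kdim k (powIdeal k (fun _ : Fin (r + 1) => m) ⊔ Ideal.span {sumX k (Fin (r + 1)) ^ m}) := by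
  rw [coe_sumDim, kdim_powIdeal_sup_sumX]

theorem sumDim_mono (r : ℕ) : Monotone (sumDim k r) := by
  intro m m' h
  rw [← Nat.cast_le (α := ℕ∞), coe_sumDim, coe_sumDim]
  exact kdim_anti (sup_le_sup_right (powIdeal_anti fun _ => h) _)

/-- After elimination there are r + 2 exponents to raise, those of the r + 1 variables and that of
their sum. Each unit costs at most (m + t)^r, since a generator made linear removes one variable. -/
theorem sumDim_add_le (r m t : ℕ) :
    sumDim k r (m + t) ≤ sumDim k r m + (r + 2) * t * (m + t) ^ r := by
  rw [← Nat.cast_le (α := ℕ∞), Nat.cast_add, coe_sumDim', coe_sumDim']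
  refine (kdim_sup_span_pow_le _ _ m t).trans ?_
  have h1 := kdim_powIdeal_const_add_le (k := k) (σ := Fin (r + 1)) m t
    (Ideal.span {sumX k (Fin (r + 1)) ^ m})
  have h2 : kdim k (powIdeal k (fun _ : Fin (r + 1) => m + t) ⊔ Ideal.span {sumX k (Fin (r + 1))}) ≤
      ((m + t) ^ r : ℕ) := by
    rw [kdim_powIdeal_sup_sumX]
    refine (kdim_powIdeal_sup_le _ _).trans (le_of_eq ?_)
    simp
  refine (add_le_add h1 (mul_le_mul_right h2 _)).trans (le_of_eq ?_)
  rw [add_assoc]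
  congr 1
  norm_cast
  rw [Fintype.card_fin, Nat.add_sub_cancel]
  ring

theorem map_expand_powIdeal {σ : Type*} [Fintype σ] (d : ℕ) (a : σ → ℕ) :
    (powIdeal k a).map (expand d) = powIdeal k fun i => d * a i := by
  rw [powIdeal, powIdeal, Ideal.map_span]
  congr 1
  rw [← Set.range_comp]
  congr 1
  funext i
  simp [pow_mul]

/-- In characteristic `p`, `expand p` sends the sum of the variables to its `p`-th power, so it
multiplies every exponent by `p`. -/
theorem sumDim_mul_char (p : ℕ) [hp : Fact p.Prime] [CharP k p] (r m : ℕ) :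
    sumDim k r (p * m) = p ^ (r + 1) * sumDim k r m := by
  have h := kdim_map_expand (k := k) p hp.out.pos
    (powIdeal k (fun _ : Fin (r + 1) => m) ⊔ Ideal.span {sumX k (Fin (r + 1)) ^ m})
  have h1 : expand p (sumX k (Fin (r + 1))) = sumX k (Fin (r + 1)) ^ p := by
    simp [sumX, sum_pow_char]
  rw [Ideal.map_sup, map_expand_powIdeal, Ideal.map_span, Set.image_singleton, map_pow, h1, ← pow_mul,
    ← coe_sumDim', ← coe_sumDim', Fintype.card_fin] at h
  exact_mod_cast h

theorem kdim_powIdeal_two_mul (r m : ℕ) :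
    kdim k (powIdeal k (fun _ : Fin (r + 2) => 2 * m) ⊔
      Ideal.span {∑ i : Fin (r + 2), (X i : MvPolynomial (Fin (r + 2)) k) ^ 2}) =
      (2 ^ (r + 2) * sumDim k r m : ℕ) := by
  have h := kdim_map_expand (k := k) 2 two_pos
    (powIdeal k (fun _ : Fin (r + 2) => m) ⊔ Ideal.span {sumX k (Fin (r + 2))})
  have h1 : expand 2 (sumX k (Fin (r + 2))) = ∑ i, X i ^ 2 := by
    simp [sumX]
  rw [Ideal.map_sup, map_expand_powIdeal, Ideal.map_span, Set.image_singleton, h1,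
    ← coe_sumDim, Fintype.card_fin] at h
  rw [h]
  push_cast
  rfl

end SumIdeal

/-! ### Comparison of e_n with `sumDim`. -/

section Frobenius

theorem frobeniusIdeal_eq {s p : ℕ} [Fact p.Prime] (h : MvPolynomial (Fin s) (ZMod p)) (n : ℕ) :
    frobeniusIdeal h n = powIdeal (ZMod p) (fun _ => p ^ n) ⊔ Ideal.span {h} := by
  rw [frobeniusIdeal, Ideal.span_insert, sup_comm]
  rfl

theorem length_quotient_frobeniusIdeal {s p : ℕ} [Fact p.Prime]
    (h : MvPolynomial (Fin s) (ZMod p)) (n : ℕ) :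
    Module.length (MvPolynomial (Fin s) (ZMod p))
      (MvPolynomial (Fin s) (ZMod p) ⧸ frobeniusIdeal h n) =
      kdim (ZMod p) (powIdeal (ZMod p) (fun _ => p ^ n) ⊔ Ideal.span {h}) := by
  rw [← frobeniusIdeal_eq]
  have hrad : Ideal.span (Set.range (X : Fin s → MvPolynomial (Fin s) (ZMod p))) ≤
      (frobeniusIdeal h n).radical := by
    rw [Ideal.span_le]
    rintro _ ⟨i, rfl⟩
    refine ⟨p ^ n, ?_⟩
    rw [frobeniusIdeal_eq]
    exact Ideal.mem_sup_left (X_pow_mem_powIdeal (fun _ => p ^ n) i)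
  obtain ⟨N, hN⟩ := Ideal.exists_pow_le_of_le_radical_of_fg hrad
    (Submodule.fg_span (Set.finite_range _))
  refine length_eq_length_of_pow_smul_eq_zero N ?_
  intro f hf x
  obtain ⟨x, rfl⟩ := Ideal.Quotient.mk_surjective x
  rw [← Ideal.Quotient.mk_eq_mk, ← Submodule.Quotient.mk_smul, Submodule.Quotient.mk_eq_zero]
  exact Ideal.mul_mem_right _ _ (hN hf)

theorem exists_length_frobeniusIdeal_sum_sq (r p : ℕ) [Fact p.Prime] (n : ℕ) :
    ∃ e : ℕ, Module.length (MvPolynomial (Fin (r + 2)) (ZMod p))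
      (MvPolynomial (Fin (r + 2)) (ZMod p) ⧸
        frobeniusIdeal (∑ i, (X i : MvPolynomial (Fin (r + 2)) (ZMod p)) ^ 2) n) = e ∧
      2 ^ (r + 2) * sumDim (ZMod p) r (p ^ n / 2) ≤ e ∧
      e ≤ 2 ^ (r + 2) * sumDim (ZMod p) r (p ^ n / 2 + 1) := by
  rw [length_quotient_frobeniusIdeal]
  refine ⟨_, (ENat.natCast_toNat (kdim_powIdeal_sup_ne_top _ _)).symm, ?_, ?_⟩
  · have H : 2 * (p ^ n / 2) ≤ p ^ n := by omega
    rw [← Nat.cast_le (α := ℕ∞), ENat.natCast_toNat (kdim_powIdeal_sup_ne_top _ _),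
      ← kdim_powIdeal_two_mul]
    exact kdim_anti (sup_le_sup_right (powIdeal_anti fun _ => H) _)
  · have H : p ^ n ≤ 2 * (p ^ n / 2 + 1) := by omega
    rw [← Nat.cast_le (α := ℕ∞), ENat.natCast_toNat (kdim_powIdeal_sup_ne_top _ _),
      ← kdim_powIdeal_two_mul]
    exact kdim_anti (sup_le_sup_right (powIdeal_anti fun _ => H) _)

end Frobenius

/-! ### Chebyshev polynomials at the angles jπ/p. -/

section Trigonometric

open Polynomial.Chebyshev

/-- The Chebyshev polynomial of the second kind, shifted so that
`shiftU b (cos θ) * sin θ = sin (b θ)`. -/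
noncomputable def shiftU (b : ℕ) (x : ℝ) : ℝ := (U ℝ ((b : ℤ) - 1)).eval x

@[simp]
theorem shiftU_zero (x : ℝ) : shiftU 0 x = 0 := by simp [shiftU]

@[simp]
theorem shiftU_one (x : ℝ) : shiftU 1 x = 1 := by simp [shiftU]

theorem shiftU_add_two (b : ℕ) (x : ℝ) : shiftU (b + 2) x + shiftU b x = 2 * x * shiftU (b + 1) x := by
  have h := congrArg (Polynomial.eval x) (U_add_two ℝ ((b : ℤ) - 1))
  simp only [Polynomial.eval_sub, Polynomial.eval_mul, Polynomial.eval_X, Polynomial.eval_ofNat] at h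
  simp only [shiftU]
  push_cast
  rw [show (b : ℤ) + 2 - 1 = (b : ℤ) - 1 + 2 by ring, show (b : ℤ) + 1 - 1 = (b : ℤ) - 1 + 1 by ring, h]
  ring

theorem shiftU_cos_mul_sin (b : ℕ) (θ : ℝ) : shiftU b (Real.cos θ) * Real.sin θ = Real.sin (b * θ) := by
  rw [shiftU, U_real_cos]
  simp

theorem shiftU_add_two_sub (b : ℕ) (θ : ℝ) :
    shiftU (b + 2) (Real.cos θ) = shiftU b (Real.cos θ) + 2 * Real.cos ((b + 1 : ℕ) * θ) := by
  have h1 := shiftU_add_two b (Real.cos θ)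
  have h2 := congrArg (Polynomial.eval (Real.cos θ)) (U_eq_X_mul_U_add_T ℝ ((b : ℤ)))
  simp only [Polynomial.eval_add, Polynomial.eval_mul, Polynomial.eval_X, T_real_cos] at h2
  have h3 : shiftU (b + 2) (Real.cos θ) =
      Real.cos θ * shiftU (b + 1) (Real.cos θ) + Real.cos ((b + 1 : ℕ) * θ) := by
    simp only [shiftU]
    push_cast at h2 ⊢
    rw [show (b : ℤ) + 2 - 1 = (b : ℤ) + 1 by ring, show (b : ℤ) + 1 - 1 = (b : ℤ) by ring]
    exact h2
  linear_combination 2 * h3 - h1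

/-- The real part of a geometric sum over the 2p-th roots of unity. -/
theorem sum_cos_mul_pi_div (p m : ℕ) (hm : 0 < m) (hmp : m < 2 * p) :
    ∑ j ∈ Finset.range (2 * p), Real.cos (m * (j * Real.pi / p)) = 0 := by
  have hp : 2 * p ≠ 0 := by omega
  have hp' : (p : ℂ) ≠ 0 := by
    have : p ≠ 0 := by omega
    exact_mod_cast this
  have hζ := Complex.isPrimitiveRoot_exp (2 * p) hp
  set ζ := Complex.exp (2 * Real.pi * Complex.I / (2 * p : ℕ)) with hζdef
  have h1 : ζ ^ m ≠ 1 := hζ.pow_ne_one_of_pos_of_lt hm.ne' hmp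
  have h2 : ∑ j ∈ Finset.range (2 * p), (ζ ^ m) ^ j = 0 := by
    have := mul_geom_sum (ζ ^ m) (2 * p)
    rw [← pow_mul, mul_comm m, pow_mul, hζ.pow_eq_one, one_pow, sub_self] at this
    exact (mul_eq_zero.mp this).resolve_left (sub_ne_zero.mpr h1)
  have h3 := congrArg Complex.re h2
  rw [Complex.re_sum, Complex.zero_re] at h3
  rw [← h3]
  refine Finset.sum_congr rfl fun j _ => ?_
  rw [hζdef, ← pow_mul, ← Complex.exp_nat_mul]
  have : (((m * j : ℕ) : ℂ) * (2 * Real.pi * Complex.I / (2 * p : ℕ))) =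
      ((m * (j * Real.pi / p) : ℝ) : ℂ) * Complex.I := by
    push_cast
    field_simp
  rw [this, Complex.exp_ofReal_mul_I_re]

/-- The initial data of the wave equation: with all a_i = 1 the dimension is 1 for every positive
exponent of the sum. -/
theorem sum_shiftU_mul_one_add_cos {p : ℕ} (hp : 2 ≤ p) (c : ℕ) (hc : c + 1 ≤ p) :
    ∑ j ∈ Finset.range (2 * p), shiftU (c + 1) (Real.cos (j * Real.pi / p)) *
      (1 + Real.cos (j * Real.pi / p)) = 2 * p := by
  induction c using Nat.twoStepInduction with
  | zero =>
    have := sum_cos_mul_pi_div p 1 one_pos (by omega)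
    simp only [Nat.cast_one, one_mul] at this
    simp [Finset.sum_add_distrib, this]
  | one =>
    have h1 := sum_cos_mul_pi_div p 1 one_pos (by omega)
    have h2 := sum_cos_mul_pi_div p 2 two_pos (by omega)
    have h : ∀ x : ℝ, shiftU (1 + 1) (Real.cos x) * (1 + Real.cos x) =
        1 + 2 * Real.cos ((1 : ℕ) * x) + Real.cos ((2 : ℕ) * x) := by
      intro x
      have := shiftU_add_two 0 (Real.cos x)
      simp only [zero_add, shiftU_zero, add_zero, shiftU_one] at this
      rw [show 1 + 1 = 2 from rfl, this]
      push_cast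
      rw [Real.cos_two_mul, one_mul]
      ring
    simp only [h, Finset.sum_add_distrib, ← Finset.mul_sum, h1, h2]
    simp
  | more c ih _ =>
    have h : ∀ x : ℝ, shiftU (c + 2 + 1) (Real.cos x) * (1 + Real.cos x) =
        shiftU (c + 1) (Real.cos x) * (1 + Real.cos x) + 2 * Real.cos ((c + 2 : ℕ) * x) +
          Real.cos ((c + 3 : ℕ) * x) + Real.cos ((c + 1 : ℕ) * x) := by
      intro x
      rw [show c + 2 + 1 = c + 1 + 2 by ring, shiftU_add_two_sub]
      have e1 : ((c + 3 : ℕ) : ℝ) * x = (c + 2 : ℕ) * x + x := by push_cast; ring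
      have e2 : ((c + 1 : ℕ) : ℝ) * x = (c + 2 : ℕ) * x - x := by push_cast; ring
      rw [e1, e2, Real.cos_add, Real.cos_sub, show c + 1 + 1 = c + 2 from rfl]
      ring
    simp only [h, Finset.sum_add_distrib, ← Finset.mul_sum]
    rw [sum_cos_mul_pi_div p (c + 2) (by omega) (by omega),
      sum_cos_mul_pi_div p (c + 3) (by omega) (by omega),
      sum_cos_mul_pi_div p (c + 1) (by omega) (by omega), ih (by omega)]
    ring

/-- Multiplying sin(pθ) = 0 by sin θ gives (1 - cos² θ) `shiftU p (cos θ)` = 0. This is what the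
degenerate equation at c = p demands; the weight 1 + cos θ is needed at θ = π. -/
theorem shiftU_boundary {p : ℕ} (hp : p ≠ 0) (j : ℕ) :
    (Real.cos (j * Real.pi / p) - 1) * shiftU p (Real.cos (j * Real.pi / p)) *
      (1 + Real.cos (j * Real.pi / p)) = 0 := by
  have hp' : (p : ℝ) ≠ 0 := by exact_mod_cast hp
  set θ := j * Real.pi / p with hθ
  have h1 : shiftU p (Real.cos θ) * Real.sin θ = 0 := by
    rw [shiftU_cos_mul_sin, hθ, mul_div_cancel₀ _ hp', Real.sin_nat_mul_pi]
  linear_combination (-Real.sin θ) * h1 + shiftU p (Real.cos θ) * Real.sin_sq_add_cos_sq θ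

end Trigonometric

/-! ### The trigonometric formula for exponents at most p. -/

section Formula

variable {k : Type*} [Field k] {σ : Type*}

theorem pderiv_mem_powIdealErase (a : σ → ℕ) (i : σ) {f : MvPolynomial σ k}
    (hf : f ∈ powIdealErase k a i) : pderiv i f ∈ powIdealErase k a i := by
  refine Submodule.span_induction ?_ ?_ ?_ ?_ hf
  · rintro _ ⟨j, hj, rfl⟩
    have : pderiv i (X j ^ a j : MvPolynomial σ k) = 0 := by
      simp [Derivation.leibniz_pow, pderiv_X_of_ne (show j ≠ i from hj)]
    simp [this]
  · simp
  · intro x y _ _ hx hy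
    rw [map_add]
    exact Ideal.add_mem _ hx hy
  · intro g x hx hDx
    rw [smul_eq_mul, Derivation.leibniz]
    exact Ideal.add_mem _ (Ideal.mul_mem_left _ _ hDx) (Ideal.mul_mem_right _ _ hx)

/-- The dimension of `k[x_i] / (x_i ^ a_i, (∑ x_i) ^ c)`. -/
noncomputable def powDim (k : Type*) [Field k] {σ : Type*} [Fintype σ] (a : σ → ℕ) (c : ℕ) : ℕ :=
  (kdim k (powIdeal k a ⊔ Ideal.span {sumX k σ ^ c})).toNat

variable [Fintype σ]

theorem powDim_of_eq_zero {a : σ → ℕ} {i : σ} (h : a i = 0) (c : ℕ) : powDim k a c = 0 := by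
  rw [powDim, powIdeal_eq_top h, top_sup_eq, kdim_top, ENat.toNat_zero]

theorem powDim_zero (a : σ → ℕ) : powDim k a 0 = 0 := by
  rw [powDim, pow_zero, Ideal.span_singleton_one, sup_top_eq, kdim_top, ENat.toNat_zero]

theorem powDim_one (c : ℕ) : powDim k (fun _ : σ => 1) (c + 1) = 1 := by
  have h : Ideal.span {sumX k σ ^ (c + 1)} ≤ powIdeal k (fun _ : σ => 1) := by
    rw [Ideal.span_singleton_le_iff_mem, pow_succ]
    refine Ideal.mul_mem_left _ _ (Ideal.sum_mem _ fun i _ => ?_)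
    simpa using X_pow_mem_powIdeal (k := k) (fun _ : σ => 1) i
  rw [powDim, sup_eq_left.mpr h, kdim_powIdeal_one]
  rfl

variable [DecidableEq σ]

theorem pderiv_sumX (i : σ) : pderiv i (sumX k σ) = 1 := by
  simp [sumX, pderiv_X, Pi.single_apply]

theorem coe_powDim (a : σ → ℕ) (c : ℕ) :
    (powDim k a c : ℕ∞) = kdim k (powIdeal k a ⊔ Ideal.span {sumX k σ ^ c}) :=
  ENat.natCast_toNat (kdim_powIdeal_sup_ne_top _ _)

theorem powDim_wave (a : σ → ℕ) (i : σ) {b c : ℕ} (hb : ((b + 1 : ℕ) : k) ≠ 0)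
    (hc : ((c + 1 : ℕ) : k) ≠ 0) :
    powDim k (Function.update a i (b + 2)) (c + 1) + powDim k (Function.update a i b) (c + 1) =
      powDim k (Function.update a i (b + 1)) (c + 2) + powDim k (Function.update a i (b + 1)) c := by
  have h := kdim_wave (k := k) (I := powIdealErase k a i) (D := pderiv i)
    (fun f hf => pderiv_mem_powIdealErase a i hf) (pderiv_X_self i) (pderiv_sumX i) hb hc
  simp only [← powIdeal_update, ← coe_powDim] at h
  exact_mod_cast h

theorem powDim_wave_boundary (a : σ → ℕ) (i : σ) {b c : ℕ} (hb : ((b + 1 : ℕ) : k) ≠ 0)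
    (hc : ((c + 1 : ℕ) : k) = 0) :
    powDim k (Function.update a i (b + 2)) (c + 1) + powDim k (Function.update a i b) (c + 1) =
      2 * powDim k (Function.update a i (b + 1)) (c + 1) := by
  have h := kdim_wave_boundary (k := k) (I := powIdealErase k a i) (D := pderiv i)
    (fun f hf => pderiv_mem_powIdealErase a i hf) (pderiv_X_self i) (pderiv_sumX i) hb hc
  simp only [← powIdeal_update, ← coe_powDim] at h
  exact_mod_cast h

/-- For exponents at most `p`, the dimension of `k[x_i] / (x_i ^ a_i, (∑ x_i) ^ c)` in
characteristic `p` is a trigonometric sum. -/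
theorem powDim_eq_sum (p : ℕ) [hp : Fact p.Prime] [CharP k p] (a : σ → ℕ) (ha : ∀ i, a i ≤ p) (c : ℕ)
    (hc : c ≤ p) :
    2 * p * (powDim k a c : ℝ) = ∑ j ∈ Finset.range (2 * p),
      (∏ i, shiftU (a i) (Real.cos (j * Real.pi / p))) * (shiftU c (Real.cos (j * Real.pi / p)) *
        (1 + Real.cos (j * Real.pi / p))) := by
  suffices H : ∀ (S : Finset σ) (a : σ → ℕ), (∀ i, a i ≤ p) → (∀ i ∉ S, a i = 1) → ∀ c ≤ p,
      2 * p * (powDim k a c : ℝ) = ∑ j ∈ Finset.range (2 * p),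
        (∏ i, shiftU (a i) (Real.cos (j * Real.pi / p))) * (shiftU c (Real.cos (j * Real.pi / p)) *
          (1 + Real.cos (j * Real.pi / p))) from H Finset.univ a ha (by simp) c hc
  -- Induction on the set of variables whose exponent may differ from 1, then in two steps on the
  -- exponent of the variable added.
  intro S
  induction S using Finset.induction_on with
  | empty =>
    intro a _ ha1 c hc
    obtain rfl : a = fun _ => 1 := funext fun i => ha1 i (Finset.notMem_empty i)
    cases c with
    | zero => simp [powDim_zero]
    | succ c =>
      rw [powDim_one]
      simp [sum_shiftU_mul_one_add_cos hp.out.two_le c hc]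
  | insert i S hi ih =>
    intro a ha ha1
    have hne : ∀ b : ℕ, b + 1 < p → ((b + 1 : ℕ) : k) ≠ 0 := fun b hb => by
      rw [Ne, CharP.cast_eq_zero_iff k p]
      exact Nat.not_dvd_of_pos_of_lt b.succ_pos hb
    have hprod : ∀ (b : ℕ) (x : ℝ), ∏ l, shiftU (Function.update a i b l) x =
        shiftU b x * ∏ l ∈ Finset.univ.erase i, shiftU (a l) x := by
      intro b x
      rw [← Finset.mul_prod_erase _ _ (Finset.mem_univ i), Function.update_self]
      congr 1
      refine Finset.prod_congr rfl fun l hl => ?_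
      rw [Function.update_of_ne (Finset.ne_of_mem_erase hl)]
    suffices G : ∀ b ≤ p, ∀ c ≤ p, 2 * p * (powDim k (Function.update a i b) c : ℝ) =
        ∑ j ∈ Finset.range (2 * p),
          (∏ l, shiftU (Function.update a i b l) (Real.cos (j * Real.pi / p))) *
            (shiftU c (Real.cos (j * Real.pi / p)) * (1 + Real.cos (j * Real.pi / p))) by
      simpa using G (a i) (ha i)
    intro b
    induction b using Nat.twoStepInduction with
    | zero =>
      intro _ c _
      rw [powDim_of_eq_zero (i := i) (by simp)]
      simp [hprod]
    | one =>
      intro h1 c hc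
      refine ih _ (fun l => ?_) (fun l hl => ?_) c hc
      · by_cases hli : l = i
        · simpa [hli] using h1
        · simpa [Function.update_of_ne hli] using ha l
      · by_cases hli : l = i
        · simp [hli]
        · rw [Function.update_of_ne hli]
          exact ha1 l (by simp [hli, hl])
    | more b ihb ihb1 =>
      intro hb c hc
      replace ihb := ihb (by omega)
      replace ihb1 := ihb1 (by omega)
      cases c with
      | zero => simp [powDim_zero]
      | succ c =>
        -- Below p the wave equation applies, and c + 2 ≤ p keeps its terms in range. At p the
        -- factor c + 1 vanishes in `k` and the degenerate form takes over.
        rcases lt_or_eq_of_le hc with hc' | hc'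
        · have h := powDim_wave (k := k) a i (hne b (by omega)) (hne c hc')
          have h' : (powDim k (Function.update a i (b + 2)) (c + 1) : ℝ) +
            powDim k (Function.update a i b) (c + 1) =
            powDim k (Function.update a i (b + 1)) (c + 2) +
            powDim k (Function.update a i (b + 1)) c := by exact_mod_cast h
          have e1 := ihb (c + 1) (by omega)
          have e2 := ihb1 (c + 2) (by omega)
          have e3 := ihb1 c (by omega)
          have : 2 * p * (powDim k (Function.update a i (b + 2)) (c + 1) : ℝ) =
            2 * p * (powDim k (Function.update a i (b + 1)) (c + 2) : ℝ) +
            2 * p * (powDim k (Function.update a i (b + 1)) c : ℝ) -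
            2 * p * (powDim k (Function.update a i b) (c + 1) : ℝ) := by
            linear_combination 2 * p * h'
          rw [this, e1, e2, e3, ← Finset.sum_add_distrib, ← Finset.sum_sub_distrib]
          refine Finset.sum_congr rfl fun j _ => ?_
          simp only [hprod]
          generalize Real.cos (j * Real.pi / p) = x
          generalize ∏ l ∈ Finset.univ.erase i, shiftU (a l) x = Q
          linear_combination (Q * shiftU (b + 1) x * (1 + x)) * shiftU_add_two c x -
            (Q * shiftU (c + 1) x * (1 + x)) * shiftU_add_two b x
        · have h := powDim_wave_boundary (k := k) a i (hne b (by omega))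
            (c := c) (by rw [hc']; exact CharP.cast_eq_zero k p)
          have h' : (powDim k (Function.update a i (b + 2)) (c + 1) : ℝ) +
            powDim k (Function.update a i b) (c + 1) =
            2 * powDim k (Function.update a i (b + 1)) (c + 1) := by exact_mod_cast h
          have e1 := ihb (c + 1) (by omega)
          have e2 := ihb1 (c + 1) (by omega)
          have : 2 * p * (powDim k (Function.update a i (b + 2)) (c + 1) : ℝ) =
            2 * (2 * p * (powDim k (Function.update a i (b + 1)) (c + 1) : ℝ)) -
            2 * p * (powDim k (Function.update a i b) (c + 1) : ℝ) := by
            linear_combination 2 * p * h'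
          rw [this, e1, e2, Finset.mul_sum, ← Finset.sum_sub_distrib]
          refine Finset.sum_congr rfl fun j _ => ?_
          have hbd := shiftU_boundary hp.out.ne_zero j
          simp only [hprod, hc']
          generalize Real.cos (j * Real.pi / p) = x at hbd ⊢
          generalize ∏ l ∈ Finset.univ.erase i, shiftU (a l) x = Q
          linear_combination (-2 * Q * shiftU (b + 1) x) * hbd -
            (Q * shiftU p x * (1 + x)) * shiftU_add_two b x

theorem two_mul_sumDim (p : ℕ) [hp : Fact p.Prime] (r m : ℕ) (hm : m ≤ p) :
    2 * p * (sumDim (ZMod p) r m : ℝ) = ∑ j ∈ Finset.range (2 * p),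
      shiftU m (Real.cos (j * Real.pi / p)) ^ (r + 2) * (1 + Real.cos (j * Real.pi / p)) := by
  have h := powDim_eq_sum (k := ZMod p) p (fun _ : Fin (r + 2) => m) (fun _ => hm) 1 hp.out.one_le
  simpa [powDim, sumDim] using h

end Formula

/-! ### The limit of the trigonometric sum as p → ∞. -/

section Limit

theorem abs_shiftU_cos_le (b : ℕ) (θ : ℝ) : |shiftU b (Real.cos θ)| ≤ b := by
  induction b using Nat.twoStepInduction with
  | zero => simp
  | one => simp
  | more b ih _ =>
    rw [shiftU_add_two_sub]
    refine (abs_add_le _ _).trans ?_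
    rw [abs_mul, abs_two]
    have := Real.abs_cos_le_one ((b + 1 : ℕ) * θ)
    push_cast at this ⊢
    linarith

/-- Multiplied by 1 - cos θ, the left side becomes sin²(mθ) ≤ 1, while Jordan's inequality gives 1 -
cos θ = 2 sin²(θ/2) ≥ 2(j/p)². -/
theorem shiftU_sq_mul_le (m : ℕ) {p j : ℕ} (hj : 0 < j) (hjp : j ≤ p) :
    shiftU m (Real.cos (j * Real.pi / p)) ^ 2 * (1 + Real.cos (j * Real.pi / p)) ≤
      (p : ℝ) ^ 2 / (2 * (j : ℝ) ^ 2) := by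
  have hp : (0 : ℝ) < p := by exact_mod_cast hj.trans_le hjp
  have hj' : (0 : ℝ) < j := by exact_mod_cast hj
  have hjp' : (j : ℝ) ≤ p := by exact_mod_cast hjp
  set θ := j * Real.pi / p with hθ
  have h0 : 0 ≤ θ / 2 := by positivity
  have h1 : θ / 2 ≤ Real.pi / 2 := by
    rw [hθ]
    have : (j : ℝ) * Real.pi / p ≤ Real.pi := by
      rw [div_le_iff₀ hp, mul_comm]
      exact mul_le_mul_of_nonneg_left hjp' Real.pi_pos.le
    linarith
  have h2 : (j : ℝ) / p ≤ Real.sin (θ / 2) := by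
    refine le_trans (le_of_eq ?_) (Real.mul_le_sin h0 h1)
    rw [hθ]
    field_simp
  have h3 : Real.cos θ = 1 - 2 * Real.sin (θ / 2) ^ 2 := by
    have := Real.cos_two_mul (θ / 2)
    rw [mul_div_cancel₀ _ two_ne_zero] at this
    rw [this, Real.cos_sq']
    ring
  have h4 : (j / p : ℝ) ^ 2 ≤ Real.sin (θ / 2) ^ 2 := pow_le_pow_left₀ (by positivity) h2 2
  have h5 : shiftU m (Real.cos θ) ^ 2 * (1 + Real.cos θ) * (1 - Real.cos θ) ≤ 1 := by
    have h6 := shiftU_cos_mul_sin m θ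
    have h7 : shiftU m (Real.cos θ) ^ 2 * (1 + Real.cos θ) * (1 - Real.cos θ) =
        Real.sin (m * θ) ^ 2 := by
      rw [← h6]
      linear_combination (-shiftU m (Real.cos θ) ^ 2) * Real.sin_sq_add_cos_sq θ
    rw [h7]
    exact Real.sin_sq_le_one _
  have h8 : 0 ≤ shiftU m (Real.cos θ) ^ 2 * (1 + Real.cos θ) :=
    mul_nonneg (sq_nonneg _) (by linarith [Real.neg_one_le_cos θ])
  have h9 : shiftU m (Real.cos θ) ^ 2 * (1 + Real.cos θ) * (2 * (j / p : ℝ) ^ 2) ≤ 1 :=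
    (mul_le_mul_of_nonneg_left (by linarith) h8).trans h5
  rw [le_div_iff₀ (by positivity)]
  have h10 := mul_le_mul_of_nonneg_right h9 (sq_nonneg (p : ℝ))
  calc _ = _ := by
        field_simp
    _ ≤ _ := h10
    _ = _ := one_mul _

/-- The normalized terms of the trigonometric sum. -/
noncomputable def normTerm (r p i : ℕ) : ℝ :=
  (2 / p : ℝ) ^ (r + 2) * (shiftU (p / 2) (Real.cos ((i + 1 : ℕ) * Real.pi / p)) ^ (r + 2) *
    (1 + Real.cos ((i + 1 : ℕ) * Real.pi / p)))

/-- A summable majorant independent of `p`: two Chebyshev factors supply the quadratic decay and the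
other `r` are bounded by `p`. -/
theorem abs_normTerm_le (r : ℕ) {p i : ℕ} (hi : i < p) :
    |normTerm r p i| ≤ 2 ^ (r + 1) * (1 / ((i + 1 : ℕ) : ℝ) ^ 2) := by
  have hp : (0 : ℝ) < p := by exact_mod_cast (Nat.zero_le i).trans_lt hi
  have h1 := shiftU_sq_mul_le (p / 2) i.succ_pos (Nat.succ_le_of_lt hi)
  set x := Real.cos ((i + 1 : ℕ) * Real.pi / p) with hx
  have h2 : |shiftU (p / 2) x| ≤ p :=
    (abs_shiftU_cos_le _ _).trans (by exact_mod_cast Nat.div_le_self p 2)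
  have hx1 : 0 ≤ 1 + x := by linarith [Real.neg_one_le_cos ((i + 1 : ℕ) * Real.pi / p)]
  have h3 : |normTerm r p i| = (2 / p : ℝ) ^ (r + 2) * (|shiftU (p / 2) x| ^ r *
      (shiftU (p / 2) x ^ 2 * (1 + x))) := by
    rw [normTerm, ← hx, abs_mul, abs_mul, abs_of_nonneg hx1, abs_pow, abs_pow, pow_add |shiftU _ x|,
      sq_abs, abs_of_nonneg (by positivity : (0 : ℝ) ≤ 2 / p)]
    ring
  rw [h3]
  calc (2 / p : ℝ) ^ (r + 2) * (|shiftU (p / 2) x| ^ r * (shiftU (p / 2) x ^ 2 * (1 + x)))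
      ≤ (2 / p : ℝ) ^ (r + 2) * ((p : ℝ) ^ r * ((p : ℝ) ^ 2 / (2 * ((i + 1 : ℕ) : ℝ) ^ 2))) := by
        gcongr
    _ = 2 ^ (r + 1) * (1 / ((i + 1 : ℕ) : ℝ) ^ 2) := by
        rw [div_pow, pow_succ 2 (r + 1), pow_add (p : ℝ)]
        field_simp

/-- The summand is invariant under j ↦ 2p - j and vanishes at j = p. The term j = 0 stands alone and
the others pair up; `normTerm r p i` belongs to j = i + 1. -/
theorem two_pow_mul_sumDim_div (r p : ℕ) [hp : Fact p.Prime] :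
    2 ^ (r + 2) * (sumDim (ZMod p) r (p / 2) : ℝ) / (p : ℝ) ^ (r + 1) =
      (2 * (p / 2 : ℕ) / p : ℝ) ^ (r + 2) + ∑ i ∈ Finset.range p, normTerm r p i := by
  have hp0 : (p : ℝ) ≠ 0 := by exact_mod_cast hp.out.ne_zero
  have h := two_mul_sumDim p r (p / 2) (Nat.div_le_self p 2)
  set g : ℕ → ℝ := fun j => shiftU (p / 2) (Real.cos (j * Real.pi / p)) ^ (r + 2) *
    (1 + Real.cos (j * Real.pi / p)) with hg
  have hrefl : ∀ j ≤ 2 * p, g (2 * p - j) = g j := by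
    intro j hj
    have : ((2 * p - j : ℕ) : ℝ) * Real.pi / p = 2 * Real.pi - j * Real.pi / p := by
      rw [Nat.cast_sub hj]
      push_cast
      field_simp
    simp only [hg, this, Real.cos_two_pi_sub]
  have hgp : g p = 0 := by
    have : (p : ℝ) * Real.pi / p = Real.pi := by field_simp
    simp only [hg, this, Real.cos_pi]
    ring
  have hg0 : g 0 = 2 * ((p / 2 : ℕ) : ℝ) ^ (r + 2) := by
    have : ∀ b : ℕ, shiftU b 1 = b := by
      intro b
      simp [shiftU, Polynomial.Chebyshev.U_eval_one]
    simp only [hg, Nat.cast_zero, zero_mul, zero_div, Real.cos_zero, this]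
    ring
  have hsum : ∑ j ∈ Finset.range (2 * p), g j = g 0 + 2 * ∑ i ∈ Finset.range p, g (i + 1) := by
    have e1 : ∑ i ∈ Finset.range p, g (p + i) = ∑ i ∈ Finset.range p, g (i + 1) := by
      rw [← Finset.sum_range_reflect]
      refine Finset.sum_congr rfl fun i hi => ?_
      rw [Finset.mem_range] at hi
      rw [← hrefl (i + 1) (by omega)]
      congr 1
      omega
    have e2 : ∑ i ∈ Finset.range p, g i = g 0 + ∑ i ∈ Finset.range p, g (i + 1) := by
      have := (Finset.sum_range_succ g p).symm.trans (Finset.sum_range_succ' g p)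
      rw [hgp] at this
      linarith
    rw [two_mul, Finset.sum_range_add, e1, e2]
    ring
  have hn : ∑ i ∈ Finset.range p, normTerm r p i =
      (2 / p : ℝ) ^ (r + 2) * ∑ i ∈ Finset.range p, g (i + 1) := by
    rw [Finset.mul_sum]
    rfl
  rw [hsum, hg0] at h
  have h' : (p : ℝ) * sumDim (ZMod p) r (p / 2) = ((p / 2 : ℕ) : ℝ) ^ (r + 2) +
      ∑ i ∈ Finset.range p, g (i + 1) := by linarith
  rw [hn, mul_div_right_comm 2 (((p / 2 : ℕ) : ℝ)) (p : ℝ), mul_pow, ← mul_add, ← h', div_pow, pow_succ (p : ℝ) (r + 1)]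
  field_simp

theorem tendsto_half_div : Tendsto (fun p : ℕ => ((p / 2 : ℕ) : ℝ) / p) atTop (𝓝 (1 / 2)) := by
  have h := (tendsto_nat_floor_mul_div_atTop (R := ℝ) (a := 1 / 2) (by norm_num)).comp
    tendsto_natCast_atTop_atTop
  refine h.congr fun p => ?_
  have : ⌊(1 / 2 : ℝ) * p⌋₊ = p / 2 := by
    rw [one_div, inv_mul_eq_div]
    exact_mod_cast Nat.floor_div_natCast (p : ℝ) 2 |>.trans (by simp)
  simp only [Function.comp, this]

theorem tendsto_mul_sin_div (c : ℝ) :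
    Tendsto (fun p : ℕ => (p : ℝ) * Real.sin (c / p)) atTop (𝓝 c) := by
  have h0 : Tendsto (fun p : ℕ => c / (p : ℝ)) atTop (𝓝 0) := tendsto_const_div_atTop_nhds_zero_nat c
  have h := ((Real.continuous_sinc.tendsto 0).comp h0).const_mul c
  rw [Real.sinc_zero, mul_one] at h
  refine h.congr' ?_
  filter_upwards [eventually_gt_atTop 0] with p hp
  have hp' : (p : ℝ) ≠ 0 := by exact_mod_cast hp.ne'
  by_cases hc : c = 0
  · simp [hc]
  · rw [Function.comp, Real.sinc_of_ne_zero (div_ne_zero hc hp')]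
    field_simp

theorem tendsto_normTerm (r i : ℕ) : Tendsto (fun p => normTerm r p i) atTop
    (𝓝 (2 * (2 * Real.sin ((i + 1 : ℕ) * Real.pi / 2) / ((i + 1 : ℕ) * Real.pi)) ^ (r + 2))) := by
  set c : ℝ := (i + 1 : ℕ) * Real.pi with hc
  have hcpos : 0 < c := by positivity
  have h0 : Tendsto (fun p : ℕ => c / (p : ℝ)) atTop (𝓝 0) := tendsto_const_div_atTop_nhds_zero_nat c
  have h1 : Tendsto (fun p : ℕ => 1 + Real.cos (c / p)) atTop (𝓝 2) := by
    have := ((Real.continuous_cos.tendsto 0).comp h0).const_add 1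
    rw [Real.cos_zero, one_add_one_eq_two] at this
    exact this
  have h2 : Tendsto (fun p : ℕ => Real.sin ((p / 2 : ℕ) * (c / p))) atTop (𝓝 (Real.sin (c / 2))) := by
    have := (Real.continuous_sin.tendsto _).comp (tendsto_half_div.mul_const c)
    refine (this.congr fun p => ?_).trans (le_of_eq ?_)
    · simp only [Function.comp]
      congr 1
      ring
    · congr 2
      ring
  have h3 := (((h2.const_mul 2).div (tendsto_mul_sin_div c) hcpos.ne').pow (r + 2)).mul h1
  rw [mul_comm] at h3
  refine h3.congr' ?_
  -- This puts c/p strictly between 0 and π, so the Chebyshev value is a quotient of sines.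
  filter_upwards [eventually_gt_atTop (i + 1)] with p hp
  have hp0 : (0 : ℝ) < p := by exact_mod_cast (Nat.zero_le _).trans_lt hp
  have hsin : Real.sin (c / p) ≠ 0 := by
    refine (Real.sin_pos_of_pos_of_lt_pi (by positivity) ?_).ne'
    rw [div_lt_iff₀ hp0, hc, mul_comm]
    exact mul_lt_mul_of_pos_left (by exact_mod_cast hp) Real.pi_pos
  simp only [Pi.div_apply]
  rw [normTerm, ← hc, ← shiftU_cos_mul_sin, ← mul_assoc ((2 / p : ℝ) ^ (r + 2)), ← mul_pow]
  congr 2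
  field_simp

theorem summable_one_div_succ_sq : Summable fun i : ℕ => 1 / ((i + 1 : ℕ) : ℝ) ^ 2 :=
  (summable_nat_add_iff 1).mpr (Real.summable_one_div_nat_pow.mpr one_lt_two)

theorem tendsto_sum_normTerm (r : ℕ) :
    Tendsto (fun p : ℕ => (2 * (p / 2 : ℕ) / p : ℝ) ^ (r + 2) + ∑ i ∈ Finset.range p, normTerm r p i)
      atTop (𝓝 (1 + ∑' i : ℕ,
        2 * (2 * Real.sin ((i + 1 : ℕ) * Real.pi / 2) / ((i + 1 : ℕ) * Real.pi)) ^ (r + 2))) := by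
  refine Tendsto.add ?_ ?_
  · have := (tendsto_half_div.const_mul 2).pow (r + 2)
    rw [mul_one_div_cancel two_ne_zero, one_pow] at this
    exact this.congr fun p => by rw [mul_div_assoc]
  · have h := tendsto_tsum_of_dominated_convergence (𝓕 := atTop)
      (f := fun p i => if i < p then normTerm r p i else 0)
      (summable_one_div_succ_sq.mul_left (2 ^ (r + 1)))
      (fun i => (tendsto_normTerm r i).congr' (by
        filter_upwards [eventually_gt_atTop i] with p hp
        rw [if_pos hp]))
      (Eventually.of_forall fun p i => by
        split_ifs with hi
        · exact abs_normTerm_le r hi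
        · rw [norm_zero]
          positivity)
    refine h.congr fun p => ?_
    rw [tsum_eq_sum (s := Finset.range p) fun i hi => if_neg (by simpa using hi)]
    exact Finset.sum_congr rfl fun i hi => if_pos (Finset.mem_range.mp hi)

end Limit

/-! ### Partial fractions and Taylor coefficients of sec z + tan z. -/

section SecTan

/-- The inverses of the poles of `sec z + tan z`. -/
noncomputable def secTanPole (n : ℤ) : ℝ := 2 / (Real.pi * (4 * n + 1))

theorem two_div_pi_le_one : 2 / Real.pi ≤ 1 :=
  (div_le_one Real.pi_pos).mpr Real.two_le_pi

theorem abs_secTanPole_le_inv_abs (n : ℤ) : |secTanPole n| ≤ 1 / |4 * (n : ℝ) + 1| := by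
  rw [secTanPole, ← div_div, abs_div, abs_of_pos (by positivity : 0 < 2 / Real.pi)]
  gcongr
  exact two_div_pi_le_one

theorem abs_secTanPole_zero_le : |secTanPole 0| ≤ 1 := by
  simpa using abs_secTanPole_le_inv_abs 0

theorem abs_secTanPole_succ_le (n : ℕ) : |secTanPole (n + 1)| ≤ 1 / ((n + 1 : ℕ) : ℝ) := by
  refine (abs_secTanPole_le_inv_abs _).trans ?_
  have : ((n + 1 : ℕ) : ℝ) ≤ |4 * (((n + 1 : ℤ)) : ℝ) + 1| := by
    refine le_trans ?_ (le_abs_self _)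
    push_cast
    linarith [(Nat.cast_nonneg n : (0 : ℝ) ≤ n)]
  gcongr

theorem abs_secTanPole_neg_succ_le (n : ℕ) : |secTanPole (-(n + 1))| ≤ 1 / ((n + 1 : ℕ) : ℝ) := by
  refine (abs_secTanPole_le_inv_abs _).trans ?_
  have : ((n + 1 : ℕ) : ℝ) ≤ |4 * ((-(n + 1) : ℤ) : ℝ) + 1| := by
    refine le_trans ?_ (neg_le_abs _)
    push_cast
    linarith [(Nat.cast_nonneg n : (0 : ℝ) ≤ n)]
  gcongr

theorem one_div_succ_le_one (n : ℕ) : 1 / ((n + 1 : ℕ) : ℝ) ≤ 1 := by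
  rw [div_le_one (by positivity)]
  exact_mod_cast Nat.succ_le_succ n.zero_le

/-- For N = 0 the single poles are only of order 1/n; pairing `n + 1` with `-(n + 1)` makes them
nearly cancel, which gives absolute convergence. -/
theorem abs_secTanPole_add_le (n N : ℕ) :
    |secTanPole (n + 1) ^ (N + 1) + secTanPole (-(n + 1)) ^ (N + 1)| ≤
      2 * (1 / ((n + 1 : ℕ) : ℝ) ^ 2) := by
  cases N with
  | zero =>
    have h : secTanPole (n + 1) + secTanPole (-(n + 1)) =
        -((2 / Real.pi) * (2 / ((4 * n + 5) * (4 * n + 3)))) := by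
      have h1 : (4 * (n : ℝ) + 5) ≠ 0 := by positivity
      have h2 : (4 * (n : ℝ) + 3) ≠ 0 := by positivity
      have h3 : (4 * ((n + 1 : ℤ) : ℝ) + 1) = 4 * n + 5 := by push_cast; ring
      have h4 : (4 * ((-(n + 1) : ℤ) : ℝ) + 1) = -(4 * n + 3) := by push_cast; ring
      have h5 := Real.pi_ne_zero
      rw [secTanPole, secTanPole, h3, h4]
      field_simp
      ring
    rw [zero_add, pow_one, pow_one, h, abs_neg, abs_of_nonneg (by positivity)]
    calc (2 / Real.pi) * (2 / ((4 * n + 5) * (4 * n + 3)))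
        ≤ 1 * (2 / ((n + 1 : ℕ) : ℝ) ^ 2) := by
          gcongr
          · exact two_div_pi_le_one
          · push_cast
            nlinarith [(Nat.cast_nonneg n : (0 : ℝ) ≤ n)]
      _ = _ := by ring
  | succ N =>
    have key : ∀ t : ℝ, |t| ≤ 1 / ((n + 1 : ℕ) : ℝ) →
        |t ^ (N + 1 + 1)| ≤ 1 / ((n + 1 : ℕ) : ℝ) ^ 2 := by
      intro t ht
      rw [abs_pow]
      calc |t| ^ (N + 1 + 1) ≤ |t| ^ 2 :=
            pow_le_pow_of_le_one (abs_nonneg t) (ht.trans (one_div_succ_le_one n)) (by omega)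
        _ ≤ (1 / ((n + 1 : ℕ) : ℝ)) ^ 2 := by gcongr
        _ = _ := by rw [div_pow, one_pow]
    refine (abs_add_le _ _).trans ?_
    linarith [key _ (abs_secTanPole_succ_le n), key _ (abs_secTanPole_neg_succ_le n)]

theorem cot_pi_div_four_sub {z : ℝ} (hz : |z| < 1) :
    Real.cot (Real.pi / 4 - z / 2) = (Real.cos z)⁻¹ + Real.tan z := by
  have hpi := Real.pi_gt_three
  obtain ⟨h1, h2⟩ := abs_lt.mp hz
  have hcos : Real.cos z ≠ 0 :=
    (Real.cos_pos_of_mem_Ioo ⟨by linarith, by linarith⟩).ne'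
  have hsin : Real.sin (Real.pi / 4 - z / 2) ≠ 0 :=
    (Real.sin_pos_of_pos_of_lt_pi (by linarith) (by linarith)).ne'
  rw [Real.cot_eq_cos_div_sin, Real.tan_eq_sin_div_cos, inv_eq_one_div, ← add_div,
    div_eq_div_iff hsin hcos, Real.cos_sub, Real.sin_sub, Real.cos_pi_div_four, Real.sin_pi_div_four]
  have e1 : Real.cos z = Real.cos (z / 2) ^ 2 - Real.sin (z / 2) ^ 2 := by
    have := Real.cos_sq_add_sin_sq (z / 2)
    have h := Real.cos_two_mul (z / 2)
    rw [mul_div_cancel₀ _ two_ne_zero] at h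
    linear_combination h + this
  have e2 : Real.sin z = 2 * Real.sin (z / 2) * Real.cos (z / 2) := by
    have h := Real.sin_two_mul (z / 2)
    rwa [mul_div_cancel₀ _ two_ne_zero] at h
  rw [e1, e2]
  linear_combination (√2 / 2 * (Real.cos (z / 2) - Real.sin (z / 2))) *
    Real.cos_sq_add_sin_sq (z / 2)

theorem one_div_quarter_sub_add {z : ℝ} (n : ℤ) (hn : 1 - secTanPole n * z ≠ 0) :
    1 / (1 / 4 - z / (2 * Real.pi) + n) = Real.pi * (2 * secTanPole n / (1 - secTanPole n * z)) := by
  have hpi := Real.pi_ne_zero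
  have h4 : (4 * (n : ℝ) + 1) ≠ 0 := by
    have : (4 * n + 1 : ℤ) ≠ 0 := by omega
    exact_mod_cast this
  have h : 1 / 4 - z / (2 * Real.pi) + n = (4 * n + 1) / 4 * (1 - secTanPole n * z) := by
    rw [secTanPole]
    field_simp
    ring
  rw [h]
  generalize hd : 1 - secTanPole n * z = d at hn
  rw [secTanPole]
  field_simp
  ring

/-- This is the partial fraction series of π cot(πw) at w = 1/4 - z/(2π), where w + n = (4n + 1)/4 ·
(1 - t_n z) with t_n = `secTanPole n`. -/
theorem secTan_eq_partialFractions {z : ℝ} (hz : |z| < 1) :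
    (Real.cos z)⁻¹ + Real.tan z = 2 * secTanPole 0 / (1 - secTanPole 0 * z) +
      ∑' n : ℕ, (2 * secTanPole (n + 1) / (1 - secTanPole (n + 1) * z) +
        2 * secTanPole (-(n + 1)) / (1 - secTanPole (-(n + 1)) * z)) := by
  have hpi := Real.pi_gt_three
  have hpi0 := Real.pi_ne_zero
  set w : ℝ := 1 / 4 - z / (2 * Real.pi) with hw
  have hw01 : 0 < w ∧ w < 1 := by
    have : |z / (2 * Real.pi)| < 1 / 6 := by
      rw [abs_div, abs_of_pos (by positivity : 0 < 2 * Real.pi), div_lt_iff₀ (by positivity)]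
      linarith
    obtain ⟨h1, h2⟩ := abs_lt.mp this
    constructor <;> rw [hw] <;> linarith
  have hwint : (w : ℂ) ∈ Complex.integerComplement := by
    rintro ⟨n, hn⟩
    have : (n : ℝ) = w := by exact_mod_cast hn
    have h1 : (0 : ℝ) < n := this ▸ hw01.1
    have h2 : (n : ℝ) < 1 := this ▸ hw01.2
    have h3 : 0 < n := by exact_mod_cast h1
    have h4 : n < 1 := by exact_mod_cast h2
    omega
  have h := cot_series_rep' hwint
  have hR : Real.pi * Real.cot (Real.pi * w) - 1 / w =
      ∑' n : ℕ, (1 / (w - (n + 1)) + 1 / (w + (n + 1))) := by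
    exact_mod_cast h
  have hne : ∀ t : ℝ, |t| ≤ 1 → 1 - t * z ≠ 0 := by
    intro t ht h0
    have : |t * z| < 1 := by
      rw [abs_mul]
      exact (mul_le_of_le_one_left (abs_nonneg z) ht).trans_lt hz
    rw [← sub_eq_zero.mp h0, abs_one] at this
    exact lt_irrefl _ this
  have hpw : Real.pi * w = Real.pi / 4 - z / 2 := by
    rw [hw]
    field_simp
  have e0 := one_div_quarter_sub_add 0 (hne _ abs_secTanPole_zero_le)
  rw [← hw, Int.cast_zero, add_zero] at e0
  have e1 : ∀ n : ℕ, 1 / (w - (n + 1)) + 1 / (w + (n + 1)) =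
      Real.pi * (2 * secTanPole (n + 1) / (1 - secTanPole (n + 1) * z) +
        2 * secTanPole (-(n + 1)) / (1 - secTanPole (-(n + 1)) * z)) := by
    intro n
    have a1 := one_div_quarter_sub_add (n + 1)
      (hne _ ((abs_secTanPole_succ_le n).trans (one_div_succ_le_one n)))
    have a2 := one_div_quarter_sub_add (-(n + 1))
      (hne _ ((abs_secTanPole_neg_succ_le n).trans (one_div_succ_le_one n)))
    rw [← hw] at a1 a2
    push_cast at a1 a2
    rw [mul_add, ← a1, ← a2, sub_eq_add_neg, add_comm]
  simp only [e1] at hR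
  rw [tsum_mul_left, e0, hpw, cot_pi_div_four_sub hz, ← mul_sub] at hR
  rw [← mul_left_cancel₀ hpi0 hR]
  ring

/-- The coefficients of the power series of `sec z + tan z`, as sums over the poles. -/
noncomputable def secTanPoleSum (N : ℕ) : ℝ :=
  2 * secTanPole 0 ^ (N + 1) +
    ∑' n : ℕ, 2 * (secTanPole (n + 1) ^ (N + 1) + secTanPole (-(n + 1)) ^ (N + 1))

theorem hasSum_secTanPole_geometric {t z : ℝ} (ht : |t| ≤ 1) (hz : |z| < 1) :
    HasSum (fun N : ℕ => 2 * t ^ (N + 1) * z ^ N) (2 * t / (1 - t * z)) := by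
  have h : |t * z| < 1 := by
    rw [abs_mul]
    exact (mul_le_of_le_one_left (abs_nonneg z) ht).trans_lt hz
  have := (hasSum_geometric_of_abs_lt_one h).mul_left (2 * t)
  rw [← div_eq_mul_inv] at this
  refine this.congr_fun ?_
  intro N
  rw [mul_pow, pow_succ]
  ring

/-- Each partial fraction is a geometric series. The double series is dominated by 4|z|^N/(n+1)², so
the sums over poles and over powers may be exchanged. -/
theorem hasSum_secTan {z : ℝ} (hz : |z| < 1) :
    HasSum (fun N : ℕ => secTanPoleSum N * z ^ N) ((Real.cos z)⁻¹ + Real.tan z) := by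
  rw [secTan_eq_partialFractions hz]
  let a : ℕ × ℕ → ℝ := fun x =>
    2 * (secTanPole (x.1 + 1) ^ (x.2 + 1) + secTanPole (-(x.1 + 1)) ^ (x.2 + 1)) * z ^ x.2
  have hsum2 : Summable fun i : ℕ => 4 * (1 / ((i + 1 : ℕ) : ℝ) ^ 2) :=
    ((summable_nat_add_iff 1).mpr (Real.summable_one_div_nat_pow.mpr one_lt_two)).mul_left 4
  have hbound : ∀ n N : ℕ, |2 * (secTanPole (n + 1) ^ (N + 1) + secTanPole (-(n + 1)) ^ (N + 1))| ≤
      4 * (1 / ((n + 1 : ℕ) : ℝ) ^ 2) := by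
    intro n N
    rw [abs_mul, abs_two]
    linarith [abs_secTanPole_add_le n N]
  have ha : Summable a := by
    refine Summable.of_norm_bounded (g := fun x : ℕ × ℕ =>
      4 * (1 / ((x.1 + 1 : ℕ) : ℝ) ^ 2) * |z| ^ x.2)
      (hsum2.mul_of_nonneg (summable_geometric_of_lt_one (abs_nonneg z) hz)
        (fun i => by positivity) (fun N => by positivity)) fun x => ?_
    rw [Real.norm_eq_abs, abs_mul, abs_pow]
    exact mul_le_mul_of_nonneg_right (hbound _ _) (by positivity)
  have hrow : ∀ n : ℕ, HasSum (fun N => a (n, N))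
      (2 * secTanPole (n + 1) / (1 - secTanPole (n + 1) * z) +
        2 * secTanPole (-(n + 1)) / (1 - secTanPole (-(n + 1)) * z)) := by
    intro n
    have h1 := hasSum_secTanPole_geometric
      ((abs_secTanPole_succ_le n).trans (one_div_succ_le_one n)) hz
    have h2 := hasSum_secTanPole_geometric
      ((abs_secTanPole_neg_succ_le n).trans (one_div_succ_le_one n)) hz
    refine (h1.add h2).congr_fun fun N => ?_
    simp only [a]
    ring
  have hcol : ∀ N : ℕ, HasSum (fun n => a (n, N))
      ((∑' n : ℕ, 2 * (secTanPole (n + 1) ^ (N + 1) + secTanPole (-(n + 1)) ^ (N + 1))) * z ^ N) :=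
    fun N => (Summable.of_norm_bounded hsum2 fun n => hbound n N).hasSum.mul_right (z ^ N)
  have hrows := ha.hasSum.prod_fiberwise hrow
  have hcols := ((Equiv.prodComm ℕ ℕ).hasSum_iff.mpr ha.hasSum).prod_fiberwise hcol
  rw [hrows.tsum_eq]
  refine ((hasSum_secTanPole_geometric abs_secTanPole_zero_le hz).add hcols).congr_fun fun N => ?_
  rw [secTanPoleSum]
  ring

theorem secTanCoeff_eq (N : ℕ) : secTanCoeff N = secTanPoleSum N := by
  have h1 : HasFPowerSeriesAt (fun z : ℝ => (Real.cos z)⁻¹ + Real.tan z)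
      (FormalMultilinearSeries.ofScalars ℝ secTanPoleSum) 0 := by
    rw [hasFPowerSeriesAt_iff]
    filter_upwards [Metric.ball_mem_nhds (0 : ℝ) one_pos] with z hz
    rw [zero_add]
    have hz' : |z| < 1 := by simpa using hz
    refine (hasSum_secTan hz').congr_fun fun N => ?_
    rw [FormalMultilinearSeries.coeff_ofScalars, smul_eq_mul, mul_comm]
  have h2 := h1.analyticAt.hasFPowerSeriesAt.eq_formalMultilinearSeries h1
  have h3 := congrArg (fun q => q.coeff N) h2
  simpa [secTanCoeff, FormalMultilinearSeries.coeff_ofScalars] using h3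

/-- With j = i + 1, sin(jπ/2) is 0 for even j, 1 for j = 4n + 1 and -1 for j = 4n + 3. The last two
cases give the poles of index n and -(n + 1). -/
theorem tsum_sin_eq_secTanPoleSum (r : ℕ) :
    ∑' i : ℕ, 2 * (2 * Real.sin ((i + 1 : ℕ) * Real.pi / 2) / ((i + 1 : ℕ) * Real.pi)) ^ (r + 2) =
      secTanPoleSum (r + 1) := by
  have hpi := Real.pi_ne_zero
  set g : ℕ → ℝ := fun i =>
    2 * (2 * Real.sin ((i + 1 : ℕ) * Real.pi / 2) / ((i + 1 : ℕ) * Real.pi)) ^ (r + 2) with hg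
  have g_odd : ∀ n, g (2 * n + 1) = 0 := by
    intro n
    have : ((2 * n + 1 + 1 : ℕ) : ℝ) * Real.pi / 2 = (n + 1 : ℕ) * Real.pi := by
      push_cast
      ring
    simp only [hg]
    rw [this, Real.sin_nat_mul_pi]
    simp
  have g_pos : ∀ n : ℕ, g (2 * (2 * n)) = 2 * secTanPole n ^ (r + 2) := by
    intro n
    have : ((2 * (2 * n) + 1 : ℕ) : ℝ) * Real.pi / 2 = Real.pi / 2 + n * (2 * Real.pi) := by
      push_cast
      ring
    simp only [hg]
    rw [this, Real.sin_add_nat_mul_two_pi, Real.sin_pi_div_two, secTanPole]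
    push_cast
    congr 3 <;> ring
  have g_neg : ∀ n : ℕ, g (2 * (2 * n + 1)) = 2 * secTanPole (-(n + 1)) ^ (r + 2) := by
    intro n
    have : ((2 * (2 * n + 1) + 1 : ℕ) : ℝ) * Real.pi / 2 =
        -(Real.pi / 2) + (n + 1 : ℕ) * (2 * Real.pi) := by
      push_cast
      ring
    simp only [hg]
    rw [this, Real.sin_add_nat_mul_two_pi, Real.sin_neg, Real.sin_pi_div_two, secTanPole]
    push_cast
    rw [show Real.pi * (4 * -((n : ℝ) + 1) + 1) = -((2 * (2 * n + 1) + 1) * Real.pi) by ring, div_neg,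
      mul_neg, neg_div, mul_one]
  have hsq : Summable fun i : ℕ => 2 * (1 / ((i + 1 : ℕ) : ℝ) ^ 2) :=
    ((summable_nat_add_iff 1).mpr (Real.summable_one_div_nat_pow.mpr one_lt_two)).mul_left 2
  have key : ∀ (n : ℕ) (t : ℝ), |t| ≤ 1 / ((n + 1 : ℕ) : ℝ) →
      ‖2 * t ^ (r + 2)‖ ≤ 2 * (1 / ((n + 1 : ℕ) : ℝ) ^ 2) := by
    intro n t ht
    rw [Real.norm_eq_abs, abs_mul, abs_two, abs_pow]
    gcongr
    calc |t| ^ (r + 2) ≤ |t| ^ 2 :=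
          pow_le_pow_of_le_one (abs_nonneg t) (ht.trans (one_div_succ_le_one n)) (by omega)
      _ ≤ (1 / ((n + 1 : ℕ) : ℝ)) ^ 2 := by gcongr
      _ = _ := by rw [div_pow, one_pow]
  have s1 : Summable fun n : ℕ => 2 * secTanPole ((n : ℤ) + 1) ^ (r + 2) :=
    Summable.of_norm_bounded hsq fun n => key n _ (abs_secTanPole_succ_le n)
  have s2 : Summable fun n : ℕ => 2 * secTanPole (-((n : ℤ) + 1)) ^ (r + 2) :=
    Summable.of_norm_bounded hsq fun n => key n _ (abs_secTanPole_neg_succ_le n)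
  have s0 : Summable fun n : ℕ => 2 * secTanPole (n : ℤ) ^ (r + 2) :=
    (summable_nat_add_iff 1).mp (by simpa using s1)
  have se : Summable fun n => g (2 * n) := by
    have := (HasSum.even_add_odd (f := fun n => g (2 * n))
      (by simpa only [g_pos] using s0.hasSum) (by simpa only [g_neg] using s2.hasSum))
    exact this.summable
  have so : Summable fun n => g (2 * n + 1) := by
    simp only [g_odd]
    exact summable_zero
  rw [← tsum_even_add_odd se so]
  simp only [g_odd, tsum_zero, add_zero]
  rw [← tsum_even_add_odd (f := fun n => g (2 * n)) (by simpa only [g_pos] using s0)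
    (by simpa only [g_neg] using s2)]
  simp only [g_pos, g_neg]
  rw [s0.tsum_eq_zero_add, secTanPoleSum]
  simp only [mul_add]
  rw [s1.tsum_add s2]
  push_cast
  ring

end SecTan

/-! ### Existence of the multiplicity, and its distance from the first approximation. -/

section Multiplicity

/-- The intervals [u_n, u_n + 2C/x^n] are nested: as x ≥ 2, the upper ends decrease. -/
theorem exists_between_of_le_add_div_pow {u : ℕ → ℝ} {x C : ℝ} (hx : 2 ≤ x) (hC : 0 ≤ C)
    (h1 : ∀ n, u n ≤ u (n + 1)) (h2 : ∀ n, u (n + 1) ≤ u n + C / x ^ n) :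
    ∃ μ, ∀ n, u n ≤ μ ∧ μ ≤ u n + 2 * C / x ^ n := by
  have hx0 : 0 < x := by linarith
  have hu : Monotone u := monotone_nat_of_le_succ h1
  have hv : Antitone fun n => u n + 2 * C / x ^ n := by
    refine antitone_nat_of_succ_le fun n => ?_
    have h3 : 2 * C / x ^ (n + 1) ≤ C / x ^ n := by
      rw [pow_succ, div_le_div_iff₀ (by positivity) (by positivity)]
      nlinarith [mul_nonneg hC (pow_nonneg hx0.le n)]
    have h4 : 2 * C / x ^ n = C / x ^ n + C / x ^ n := by ring
    linarith [h2 n]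
  have huv : ∀ m n, u m ≤ u n + 2 * C / x ^ n := by
    intro m n
    have hpos : ∀ k, u k ≤ u k + 2 * C / x ^ k := fun k => by
      have : 0 ≤ 2 * C / x ^ k := by positivity
      linarith
    exact (hu (le_max_left m n)).trans ((hpos _).trans (hv (le_max_right m n)))
  exact ⟨⨆ n, u n, fun n => ⟨le_ciSup ⟨_, Set.forall_mem_range.mpr fun m => huv m 0⟩ n,
    ciSup_le fun m => huv m n⟩⟩

/-- The floors ⌊pq/2⌋ and p⌊q/2⌋ differ by at most `p`, so Frobenius scaling and the growth bound
apply. -/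
theorem sumDim_half_mul_le (r p : ℕ) [hp : Fact p.Prime] (q : ℕ) :
    sumDim (ZMod p) r (p * q / 2) ≤
      p ^ (r + 1) * sumDim (ZMod p) r (q / 2) + (r + 2) * p * (p * q) ^ r := by
  have h1 : p * (q / 2) ≤ p * q / 2 := Nat.mul_div_le_mul_div_assoc p q 2
  obtain ⟨t, ht⟩ := Nat.exists_eq_add_of_le h1
  have htp : t ≤ p := by
    have h3 : q ≤ 2 * (q / 2) + 1 := by omega
    have h4 := Nat.mul_le_mul_left p h3
    have h5 : p * q / 2 * 2 ≤ p * q := Nat.div_mul_le_self _ _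
    have h6 : p * (2 * (q / 2) + 1) = 2 * (p * (q / 2)) + p := by ring
    omega
  have h2 := sumDim_add_le (k := ZMod p) r (p * (q / 2)) t
  rw [← ht, sumDim_mul_char p] at h2
  refine h2.trans ?_
  gcongr
  exact Nat.div_le_self _ _

theorem le_sumDim_half_mul (r p : ℕ) [hp : Fact p.Prime] (q : ℕ) :
    p ^ (r + 1) * sumDim (ZMod p) r (q / 2) ≤ sumDim (ZMod p) r (p * q / 2) := by
  rw [← sumDim_mul_char p]
  exact sumDim_mono r (Nat.mul_div_le_mul_div_assoc p q 2)

theorem exists_isHilbertKunzMultiplicity (r p : ℕ) [hp : Fact p.Prime] :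
    ∃ μ : ℝ, IsHilbertKunzMultiplicity
        (∑ i, (X i : MvPolynomial (Fin (r + 2)) (ZMod p)) ^ 2) μ ∧
      2 ^ (r + 2) * (sumDim (ZMod p) r (p / 2) : ℝ) / (p : ℝ) ^ (r + 1) ≤ μ ∧
      μ ≤ 2 ^ (r + 2) * (sumDim (ZMod p) r (p / 2) : ℝ) / (p : ℝ) ^ (r + 1) +
        2 * (2 ^ (r + 2) * (r + 2)) / p := by
  have hp0 : (0 : ℝ) < p := by exact_mod_cast hp.out.pos
  have hp2 : (2 : ℝ) ≤ p := by exact_mod_cast hp.out.two_le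
  set C : ℝ := 2 ^ (r + 2) * (r + 2) with hC
  have hC0 : 0 ≤ C := by positivity
  let u : ℕ → ℝ := fun n =>
    2 ^ (r + 2) * (sumDim (ZMod p) r (p ^ n / 2) : ℝ) / ((p : ℝ) ^ n) ^ (r + 1)
  have h1 : ∀ n, u n ≤ u (n + 1) := by
    intro n
    have h := le_sumDim_half_mul r p (p ^ n)
    rw [← pow_succ' p n] at h
    have h' : (p : ℝ) ^ (r + 1) * sumDim (ZMod p) r (p ^ n / 2) ≤
        sumDim (ZMod p) r (p ^ (n + 1) / 2) := by exact_mod_cast h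
    simp only [u]
    rw [div_le_div_iff₀ (by positivity) (by positivity), pow_succ' (p : ℝ) n, mul_pow]
    nlinarith [mul_le_mul_of_nonneg_left h'
      (by positivity : (0 : ℝ) ≤ 2 ^ (r + 2) * ((p : ℝ) ^ n) ^ (r + 1))]
  have h2 : ∀ n, u (n + 1) ≤ u n + C / (p : ℝ) ^ n := by
    intro n
    have h := sumDim_half_mul_le r p (p ^ n)
    rw [← pow_succ' p n] at h
    have h' : (sumDim (ZMod p) r (p ^ (n + 1) / 2) : ℝ) ≤
        (p : ℝ) ^ (r + 1) * sumDim (ZMod p) r (p ^ n / 2) +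
          (r + 2) * p * ((p : ℝ) ^ (n + 1)) ^ r := by exact_mod_cast h
    have h3 : u n + C / (p : ℝ) ^ n = 2 ^ (r + 2) *
        ((p : ℝ) ^ (r + 1) * sumDim (ZMod p) r (p ^ n / 2) +
          (r + 2) * p * ((p : ℝ) ^ (n + 1)) ^ r) / ((p : ℝ) ^ (n + 1)) ^ (r + 1) := by
      simp only [u, hC]
      rw [pow_succ (p : ℝ) n, mul_pow, mul_pow, pow_succ ((p : ℝ) ^ n) r, pow_succ (p : ℝ) r]
      field_simp
    rw [h3]
    simp only [u]
    gcongr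
  obtain ⟨μ, hμ⟩ := exists_between_of_le_add_div_pow hp2 hC0 h1 h2
  refine ⟨μ, ?_, ?_, ?_⟩
  · choose e he hle hge using exists_length_frobeniusIdeal_sum_sq r p
    refine ⟨e, he, ?_⟩
    rw [show r + 2 - 1 = r + 1 from rfl, show r + 2 - 2 = r from rfl]
    -- The part 2C bounds μ - u_n; the part C·2^r comes from passing from ⌊q/2⌋ to ⌊q/2⌋ + 1 ≤ 2q.
    refine IsBigO.of_bound (2 * C + C * 2 ^ r) (Eventually.of_forall fun n => ?_)
    obtain ⟨hμ1, hμ2⟩ := hμ n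
    have hq : (0 : ℝ) < (p : ℝ) ^ n := by positivity
    have hu : u n * ((p : ℝ) ^ n) ^ (r + 1) = 2 ^ (r + 2) * sumDim (ZMod p) r (p ^ n / 2) := by
      simp only [u]
      field_simp
    have hle' : 2 ^ (r + 2) * (sumDim (ZMod p) r (p ^ n / 2) : ℝ) ≤ e n := by exact_mod_cast hle n
    have hge' : (e n : ℝ) ≤ 2 ^ (r + 2) * sumDim (ZMod p) r (p ^ n / 2) +
        C * 2 ^ r * ((p : ℝ) ^ n) ^ r := by
      have h3 := (hge n).trans (Nat.mul_le_mul_left _ (sumDim_add_le (k := ZMod p) r (p ^ n / 2) 1))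
      have h4 : p ^ n / 2 + 1 ≤ 2 * p ^ n := by
        have := Nat.pow_pos (n := n) hp.out.pos
        omega
      have h5 := h3.trans (Nat.mul_le_mul_left _ (Nat.add_le_add_left
        (Nat.mul_le_mul_left ((r + 2) * 1) (Nat.pow_le_pow_left h4 r)) _))
      have h6 : (e n : ℝ) ≤ 2 ^ (r + 2) * (sumDim (ZMod p) r (p ^ n / 2) +
          (r + 2) * 1 * (2 * (p : ℝ) ^ n) ^ r) := by exact_mod_cast h5
      refine h6.trans (le_of_eq ?_)
      rw [hC, mul_pow]
      ring
    have hμ1' := mul_le_mul_of_nonneg_right hμ1 (pow_nonneg hq.le (r + 1))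
    have hμ2' := mul_le_mul_of_nonneg_right hμ2 (pow_nonneg hq.le (r + 1))
    rw [hu] at hμ1'
    rw [add_mul, hu] at hμ2'
    have hCq : 2 * C / (p : ℝ) ^ n * ((p : ℝ) ^ n) ^ (r + 1) = 2 * C * ((p : ℝ) ^ n) ^ r := by
      rw [pow_succ ((p : ℝ) ^ n) r]
      field_simp
    rw [hCq] at hμ2'
    have hqr : (0 : ℝ) ≤ ((p : ℝ) ^ n) ^ r := by positivity
    have hCr : 0 ≤ C * 2 ^ r * ((p : ℝ) ^ n) ^ r := by positivity
    have hCr' : 0 ≤ 2 * C * ((p : ℝ) ^ n) ^ r := by positivity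
    rw [Real.norm_eq_abs, Real.norm_eq_abs, abs_of_nonneg hqr, abs_le, add_mul]
    constructor <;> linarith
  -- Taking n = 1 gives bounds uniform in `p`, with error 2C/p.
  · simpa [u] using (hμ 1).1
  · simpa [u] using (hμ 1).2

end Multiplicity

theorem theorem3p8 (s : ℕ) (hs : 2 ≤ s) :
    ∃ μ : ℕ → ℝ,
      (∀ p : ℕ, p.Prime →
        IsHilbertKunzMultiplicity (∑ i : Fin s, (X i : MvPolynomial (Fin s) (ZMod p)) ^ 2) (μ p)) ∧
      Tendsto μ (atTop ⊓ 𝓟 {p : ℕ | p.Prime}) (𝓝 (1 + secTanCoeff (s - 1))) := by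
  obtain ⟨r, rfl⟩ := Nat.exists_eq_add_of_le' hs
  let L : ℕ → ℝ := fun p =>
    (2 * (p / 2 : ℕ) / p : ℝ) ^ (r + 2) + ∑ i ∈ Finset.range p, normTerm r p i
  have hex : ∀ p : ℕ, ∃ μ : ℝ, p.Prime → IsHilbertKunzMultiplicity
      (∑ i : Fin (r + 2), (X i : MvPolynomial (Fin (r + 2)) (ZMod p)) ^ 2) μ ∧
      L p ≤ μ ∧ μ ≤ L p + 2 * (2 ^ (r + 2) * (r + 2)) / p := by
    intro p
    by_cases hp : p.Prime
    · have : Fact p.Prime := ⟨hp⟩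
      obtain ⟨μ, h1, h2, h3⟩ := exists_isHilbertKunzMultiplicity r p
      rw [two_pow_mul_sumDim_div] at h2 h3
      exact ⟨μ, fun _ => ⟨h1, h2, h3⟩⟩
    -- The value at non-primes is arbitrary, as the limit runs through primes only.
    · exact ⟨0, fun h => absurd h hp⟩
  choose μ hμ using hex
  refine ⟨μ, fun p hp => (hμ p hp).1, ?_⟩
  have hL : Tendsto L (atTop ⊓ 𝓟 {p : ℕ | p.Prime}) (𝓝 (1 + secTanCoeff (r + 2 - 1))) := by
    have := tendsto_sum_normTerm r
    rw [tsum_sin_eq_secTanPoleSum, ← secTanCoeff_eq] at this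
    exact this.mono_left inf_le_left
  have hU : Tendsto (fun p : ℕ => L p + 2 * (2 ^ (r + 2) * (r + 2)) / (p : ℝ))
      (atTop ⊓ 𝓟 {p : ℕ | p.Prime}) (𝓝 (1 + secTanCoeff (r + 2 - 1))) := by
    have := hL.add ((tendsto_const_div_atTop_nhds_zero_nat
      (2 * (2 ^ (r + 2) * ((r : ℝ) + 2)))).mono_left (inf_le_left (b := 𝓟 {p : ℕ | p.Prime})))
    rwa [add_zero] at this
  have hprime : ∀ᶠ p in atTop ⊓ 𝓟 {p : ℕ | p.Prime}, p.Prime :=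
    mem_inf_of_right (mem_principal_self _)
  refine tendsto_of_tendsto_of_tendsto_of_le_of_le' hL hU ?_ ?_
  · filter_upwards [hprime] with p hp using (hμ p hp).2.1
  · filter_upwards [hprime] with p hp using (hμ p hp).2.2
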